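/- Let $\mathfrak H$ be a real separable Hilbert space and let $X=\{X(h):h\in\mathfrak H\}$ be a centered isonormal Gaussian process on a probability space $(\Omega,\mathscr F,P)$, i.e. a family of centered, jointly Gaussian random variables with $E[X(h)X(k)]=\langle h,k\rangle_{\mathfrak H}$. Let $D$ be the Malliavin derivative: $DF=\sum_{i}\partial_i f(X(\phi_1),\dots,X(\phi_n))\,\phi_i$ for smooth cylindrical $F=f(X(\phi_1),\dots,X(\phi_n))$ ($n\ge 1$, $f\in C_c^\infty(\mathbb R^n)$, $\phi_i\in\mathfrak H$), extended by closure to its domain $\mathbb D^{1,2}$, the closure of the smooth cylindrical variables for the norm $(E[F^2]+E\|DF\|_{\mathfrak H}^2)^{1/2}$. Let $J_m$ be the orthogonal projection of $L^2(\Omega)$ onto the $m$-th Wiener chaos of $X$ and let $L^{-1}F=-\sum_{m\ge1}\frac1m J_mF$ (the inverse of the Ornstein–Uhlenbeck generator $L=-\sum_{m\ge 0} mJ_m$). **Theorem 4.1 (concentration).** Let $Z\in\mathbb D^{1,2}$ have zero mean, put $$g(Z)=E\big[\langle DZ,-DL^{-1}Z\rangle_{\mathfrak H}\,\big|\,Z\big],$$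 and let $\alpha\ge0$, $\beta>0$. Assume that (i) $g(Z)\le\alpha Z+\beta$ almost surely; (ii) $Z$ has a density with respect to Lebesgue measure. Then, for all $z>0$, $$P(Z\ge z)\le\exp\Big(-\frac{z^2}{2\alpha z+2\beta}\Big).$$ Moreover, the Borell/Vitale tail bounds for centered Gaussian maxima hold: if $n\ge 1$, $N=(N_1,\dots,N_n)$ is a centered Gaussian random vector on $(\Omega,\mathscr F,P)$, $\sigma_{\max}^2=\max_i \mathrm{Var}(N_i)>0$, and $M=\max_i N_i-E[\max_i N_i]$, then for all $z>0$ $$P(M\ge z)\le\exp\Big(-\frac{z^2}{2\sigma_{\max}^2}\Big)\quad\text{and}\quad P(M\le -z)\le\exp\Big(-\frac{z^2}{2\sigma_{\max}^2}\Big).$$ -/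

import Mathlib

open MeasureTheory ProbabilityTheory

noncomputable section

namespace Malliavin

/-- `X = {X(h) : h ∈ H}` is a centered isonormal Gaussian process over the Hilbert space `H`:
a jointly Gaussian family of centered random variables with `E[X(h) X(k)] = ⟨h, k⟩`. -/
structure IsIsonormal {Ω H : Type*} [MeasurableSpace Ω] [NormedAddCommGroup H]
    [InnerProductSpace ℝ H] (X : H → Ω → ℝ) (P : Measure Ω) : Prop where
  measurable : ∀ h, Measurable (X h)
  gaussian : IsGaussianProcess X P
  centered : ∀ h, ∫ ω, X h ω ∂P = 0
  covariance : ∀ h k, ∫ ω, X h ω * X k ω ∂P = inner ℝ h k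

section Operators

variable {Ω H : Type*} [MeasurableSpace Ω] [NormedAddCommGroup H] [InnerProductSpace ℝ H]

/-- `F = f(X(φ₁), …, X(φₙ))` with `n ≥ 1` and `f` smooth with compact support, and
`u = ∑ᵢ ∂ᵢf(X(φ₁), …, X(φₙ)) φᵢ` is its Malliavin derivative. -/
def IsSmoothCylinder (X : H → Ω → ℝ) (P : Measure Ω) (F : Lp ℝ 2 P) (u : Lp H 2 P) : Prop :=
  ∃ (n : ℕ) (f : (Fin n → ℝ) → ℝ) (φ : Fin n → H),
    1 ≤ n ∧ ContDiff ℝ ((⊤ : ℕ∞) : WithTop ℕ∞) f ∧ HasCompactSupport f ∧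
    (F =ᵐ[P] fun ω => f (fun i => X (φ i) ω)) ∧
    (u =ᵐ[P] fun ω => ∑ i, (fderiv ℝ f (fun j => X (φ j) ω) (Pi.single i 1)) • φ i)

/-- The graph of the closed Malliavin derivative: the closed linear subspace of
`L²(Ω) × L²(Ω; H)` generated by the pairs `(F, DF)` with `F` smooth cylindrical. The topology
of the product is that of the norm `(E[F²] + E[‖DF‖²])^(1/2)`. -/
def derivGraph (X : H → Ω → ℝ) (P : Measure Ω) : Submodule ℝ (Lp ℝ 2 P × Lp H 2 P) :=
  (Submodule.span ℝ {p | IsSmoothCylinder X P p.1 p.2}).topologicalClosure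

/-- The space `𝔻^{1,2}`, the domain of the closed Malliavin derivative. -/
def D12 (X : H → Ω → ℝ) (P : Measure Ω) : Submodule ℝ (Lp ℝ 2 P) :=
  (derivGraph X P).map (LinearMap.fst ℝ (Lp ℝ 2 P) (Lp H 2 P))

open Classical in
/-- The Malliavin derivative `DF ∈ L²(Ω; H)` of `F ∈ 𝔻^{1,2}`: the element `u` such that `(F, u)`
lies in the graph (for an isonormal `X` it is unique, since `D` is closable).
The value is `0` when `F ∉ 𝔻^{1,2}`. -/
def deriv (X : H → Ω → ℝ) (P : Measure Ω) (F : Lp ℝ 2 P) : Lp H 2 P :=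
  if h : ∃ u, (F, u) ∈ derivGraph X P then h.choose else 0

/-- The `m`-th Wiener chaos: the closed linear subspace of `L²(Ω)` generated by the variables
`Hₘ(X(h))`, `‖h‖ = 1`, where `Hₘ` is the `m`-th (probabilists') Hermite polynomial. For `m = 0` it
is the space of constants (also when `H` has no unit vector). -/
def wienerChaos (X : H → Ω → ℝ) (P : Measure Ω) (m : ℕ) : Submodule ℝ (Lp ℝ 2 P) :=
  (Submodule.span ℝ {F : Lp ℝ 2 P | ∃ h : H, (m = 0 ∨ ‖h‖ = 1) ∧
    F =ᵐ[P] fun ω => Polynomial.aeval (X h ω) (Polynomial.hermite m)}).topologicalClosure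

instance (X : H → Ω → ℝ) (P : Measure Ω) (m : ℕ) : CompleteSpace (wienerChaos X P m) :=
  (Submodule.isClosed_topologicalClosure _).completeSpace_coe

/-- `Jₘ`, the orthogonal projection of `L²(Ω)` onto the `m`-th Wiener chaos. -/
def chaosProj (X : H → Ω → ℝ) (P : Measure Ω) (m : ℕ) : Lp ℝ 2 P →L[ℝ] Lp ℝ 2 P :=
  (wienerChaos X P m).starProjection

/-- The inverse `L⁻¹ F = ∑_{m ≥ 1} -(1/m) Jₘ F` of the Ornstein-Uhlenbeck generator
`L = ∑_{m ≥ 0} -m Jₘ`. The series converges in `L²(Ω)`. -/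
def ouInv (X : H → Ω → ℝ) (P : Measure Ω) (F : Lp ℝ 2 P) : Lp ℝ 2 P :=
  ∑' m : ℕ, (-(1 / ((m : ℝ) + 1))) • chaosProj X P (m + 1) F

/-- The random variable `⟨DF, -D L⁻¹ F⟩_H`. -/
def steinPairing (X : H → Ω → ℝ) (P : Measure Ω) (F : Lp ℝ 2 P) : Ω → ℝ :=
  fun ω => inner ℝ (deriv X P F ω) ((-(deriv X P (ouInv X P F)) : Lp H 2 P) ω)

/-- The random variable `g(Z) = E[⟨DZ, -D L⁻¹ Z⟩_H | Z]`, the conditional expectation given the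
`σ`-field generated by `Z`. -/
def gOf (X : H → Ω → ℝ) (P : Measure Ω) (Z : Ω → ℝ) (hZ : MemLp Z 2 P) : Ω → ℝ :=
  P[steinPairing X P (hZ.toLp Z) | MeasurableSpace.comap Z (inferInstance : MeasurableSpace ℝ)]

end Operators

/-- The centered maximum `maxᵢ Nᵢ - E[maxᵢ Nᵢ]`. -/
def centeredMax {Ω : Type*} [MeasurableSpace Ω] (P : Measure Ω) {n : ℕ} (N : Fin n → Ω → ℝ) :
    Ω → ℝ :=
  fun ω => (⨆ i, N i ω) - ∫ ω', (⨆ i, N i ω') ∂P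

end Malliavin

end

/-! Both halves rest on one analytic lemma, `tail_bound`. Suppose `E[k(Z) Z] ≤ E[k'(Z) (α Z + β)]`
for all smooth `k` with bounded nonnegative derivative. Taking formally `k(x) = e^{θx}`, the Laplace
transform `m(θ) = E[e^{θZ}]` satisfies `(1 - αθ) m'(θ) ≤ βθ m(θ)`. On `[0, T]` with `T = z / (αz +
β)` one has `1 - αθ ≥ β / (αz + β)`, so Gronwall gives `m(T) ≤ exp((αz + β) T² / 2)`, and Markov's
inequality at `T` gives the stated exponent. Since exponential moments are not known beforehand, the
exponential is replaced by a primitive of `θ e^{θx} ψ(x)` with a cutoff `ψ`, removed at the end.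

For the first half the inequality comes from `E[k(Z) Z] = E[k'(Z) ⟨DZ, -D L⁻¹Z⟩]`
(`integral_comp_mul`), conditioning on `Z` and the bound on `g(Z)`. Integration by parts for Hermite
polynomials shows that each `G` in the `m`-th chaos satisfies `E⟨DF, DG⟩ = m E[F G]` for all `F` in
the domain (`hermitePair_eigen`, `exists_mem_eigenGraph`). The weights `1/m` of `L⁻¹` cancel these
eigenvalues, so that `E⟨DF, -D L⁻¹Z⟩ = ∑ E[F JₘZ] = E[F Z]` (`exists_deriv_ouInv`); the chain rule
(`derivGraph_comp`) applies this to `F = k(Z)`. The sum equals `Z` because the chaoses are total in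
the closure of the cylindrical variables (`eq_zero_of_orthogonal_chaos`): orthogonality to Hermite
polynomials kills moments, then characteristic functions. The `σ`-field of `Ω` may be larger than
that of `X`, so totality is only available, and only needed, in that closure.

For the second half the Gaussian vector need not be a function of `X`; the argument is made directly
on its law. Interpolating between a Gaussian variable and an independent copy by rotations bounds a
covariance `Cov(f, h)` by the gradients paired through the covariance operator
(`covariance_le_of_interpolation`). With `f = F - E[F]` and `h = k(f)` this is the hypothesis of
`tail_bound` with `α = 0`, where `F` is plus or minus a log-sum-exp smoothing of the maximum. The
gradient of log-sum-exp is a probability vector, so the constant is the largest variance; letting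
the smoothing vanish gives both tails. -/

open MeasureTheory ProbabilityTheory

noncomputable section

namespace Malliavin

open Filter Topology

/-! ### Functions of at most exponential growth -/

section ExpGrowth

variable {E F G : Type*} [NormedAddCommGroup E] [NormedAddCommGroup F] [NormedAddCommGroup G]

/-- `f` grows at most exponentially in the norm of its argument. -/
def ExpGrowth (f : E → F) : Prop :=
  ∃ C c : ℝ, 0 ≤ C ∧ 0 ≤ c ∧ ∀ x, ‖f x‖ ≤ C * Real.exp (c * ‖x‖)

lemma ExpGrowth.of_norm_le {f : E → F} {g : E → G} (hf : ExpGrowth f) (h : ∀ x, ‖g x‖ ≤ ‖f x‖) :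
    ExpGrowth g := by
  obtain ⟨C, c, hC, hc, hf⟩ := hf
  exact ⟨C, c, hC, hc, fun x => (h x).trans (hf x)⟩

lemma ExpGrowth.of_bound {f : E → F} (C : ℝ) (h : ∀ x, ‖f x‖ ≤ C) : ExpGrowth f :=
  ⟨C, 0, (norm_nonneg _).trans (h 0), le_rfl, fun x => by simpa using h x⟩

lemma ExpGrowth.const (a : F) : ExpGrowth (fun _ : E => a) := .of_bound ‖a‖ fun _ => le_rfl

lemma ExpGrowth.add {f g : E → F} (hf : ExpGrowth f) (hg : ExpGrowth g) :
    ExpGrowth (fun x => f x + g x) := by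
  obtain ⟨C, c, hC, hc, hf⟩ := hf
  obtain ⟨D, d, hD, hd, hg⟩ := hg
  refine ⟨C + D, max c d, by positivity, by positivity, fun x => ?_⟩
  calc ‖f x + g x‖ ≤ ‖f x‖ + ‖g x‖ := norm_add_le _ _
    _ ≤ C * Real.exp (c * ‖x‖) + D * Real.exp (d * ‖x‖) := add_le_add (hf x) (hg x)
    _ ≤ C * Real.exp (max c d * ‖x‖) + D * Real.exp (max c d * ‖x‖) := by
      gcongr <;> simp
    _ = _ := by ring

lemma ExpGrowth.of_norm_le_mul {f : E → F} {g : E → G} {H : Type*} [NormedAddCommGroup H]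
    {k : E → H} (hf : ExpGrowth f) (hg : ExpGrowth g)
    (h : ∀ x, ‖k x‖ ≤ ‖f x‖ * ‖g x‖) : ExpGrowth k := by
  obtain ⟨C, c, hC, hc, hf⟩ := hf
  obtain ⟨D, d, hD, hd, hg⟩ := hg
  refine ⟨C * D, c + d, by positivity, by positivity, fun x => (h x).trans ?_⟩
  calc ‖f x‖ * ‖g x‖ ≤ (C * Real.exp (c * ‖x‖)) * (D * Real.exp (d * ‖x‖)) := by
        gcongr
        exacts [hf x, hg x]
    _ = _ := by rw [add_mul, Real.exp_add]; ring

lemma ExpGrowth.mul {f g : E → ℝ} (hf : ExpGrowth f) (hg : ExpGrowth g) :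
    ExpGrowth (fun x => f x * g x) := hf.of_norm_le_mul hg fun _ => norm_mul_le _ _

lemma ExpGrowth.smul [NormedSpace ℝ F] {f : E → ℝ} {g : E → F} (hf : ExpGrowth f)
    (hg : ExpGrowth g) : ExpGrowth (fun x => f x • g x) :=
  hf.of_norm_le_mul hg fun _ => norm_smul_le _ _

lemma ExpGrowth.pow {f : E → ℝ} (hf : ExpGrowth f) (k : ℕ) : ExpGrowth (fun x => f x ^ k) := by
  induction k with
  | zero => simpa using ExpGrowth.const (1 : ℝ)
  | succ k ih => simpa only [pow_succ] using ih.mul hf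

lemma expGrowth_id : ExpGrowth (fun x : E => x) :=
  ⟨1, 1, zero_le_one, zero_le_one, fun x => by
    have := Real.add_one_le_exp ‖x‖
    simp only [one_mul]; linarith⟩

lemma ExpGrowth.comp_lipschitz {f : F → G} (hf : ExpGrowth f) {g : E → F} {A K : ℝ}
    (hK : 0 ≤ K) (hg : ∀ x, ‖g x‖ ≤ A + K * ‖x‖) : ExpGrowth (fun x => f (g x)) := by
  obtain ⟨C, c, hC, hc, hf⟩ := hf
  refine ⟨C * Real.exp (c * A), c * K, by positivity, by positivity, fun x => (hf _).trans ?_⟩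
  rw [mul_assoc, ← Real.exp_add]
  gcongr
  calc c * ‖g x‖ ≤ c * (A + K * ‖x‖) := by gcongr; exact hg x
    _ = _ := by ring

variable [NormedSpace ℝ E] [NormedSpace ℝ F]

lemma expGrowth_clm (L : E →L[ℝ] F) : ExpGrowth (fun x => L x) :=
  (ExpGrowth.const (E := E) ‖L‖).of_norm_le_mul expGrowth_id fun x => by simpa using L.le_opNorm x

lemma ExpGrowth.comp_clm {f : F → G} (hf : ExpGrowth f) (L : E →L[ℝ] F) :
    ExpGrowth (fun x => f (L x)) :=
  hf.comp_lipschitz (A := 0) (norm_nonneg L) fun x => by simpa using L.le_opNorm x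

lemma ExpGrowth.clm_comp {f : G → E} (hf : ExpGrowth f) (L : E →L[ℝ] F) :
    ExpGrowth (fun x => L (f x)) :=
  (ExpGrowth.const (E := G) ‖L‖).of_norm_le_mul hf fun x => by simpa using L.le_opNorm (f x)

lemma ExpGrowth.clm_comp_apply {f : G → E →L[ℝ] F} (hf : ExpGrowth f) (a : E) :
    ExpGrowth (fun x => f x a) :=
  hf.of_norm_le_mul (ExpGrowth.const a) fun x => (f x).le_opNorm a

end ExpGrowth

/-! ### Gaussian integrability and integration by parts -/

section IBP

variable {Ω E F : Type*} [MeasurableSpace Ω] {P : Measure Ω}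
  [NormedAddCommGroup E] [NormedSpace ℝ E] [CompleteSpace E] [SecondCountableTopology E]
  [MeasurableSpace E] [BorelSpace E] [NormedAddCommGroup F]

/-- Fernique's theorem gives a finite `E[exp(C‖V‖²)]` for some `C > 0`, and completing the square
yields `c‖V‖ ≤ c² / (4C) + C‖V‖²`. -/
lemma integrable_exp_norm_of_gaussian {V : Ω → E} (hV : HasGaussianLaw V P) (c : ℝ) :
    Integrable (fun ω => Real.exp (c * ‖V ω‖)) P := by
  have := hV.isGaussian_map
  obtain ⟨C, hC, hi⟩ := IsGaussian.exists_integrable_exp_sq (P.map V)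
  rw [integrable_map_measure (by fun_prop) hV.aemeasurable] at hi
  refine (hi.const_mul (Real.exp (c ^ 2 / (4 * C)))).mono' ?_ (.of_forall fun ω => ?_)
  · have := hV.aemeasurable
    exact (Measurable.comp_aemeasurable (by fun_prop) this : AEMeasurable
      ((fun x : E => Real.exp (c * ‖x‖)) ∘ V) P).aestronglyMeasurable
  · simp only [Function.comp, Real.norm_eq_abs, Real.abs_exp, ← Real.exp_add]
    gcongr
    have : 0 ≤ (2 * C * ‖V ω‖ - c) ^ 2 / (4 * C) := by positivity
    have h2 : (2 * C * ‖V ω‖ - c) ^ 2 / (4 * C) =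
        c ^ 2 / (4 * C) + C * ‖V ω‖ ^ 2 - c * ‖V ω‖ := by field_simp; ring
    linarith

lemma ExpGrowth.integrable {V : Ω → E} (hV : HasGaussianLaw V P) {f : E → F} (hf : ExpGrowth f)
    (hm : AEStronglyMeasurable (fun ω => f (V ω)) P) : Integrable (fun ω => f (V ω)) P := by
  obtain ⟨C, c, hC, hc, hf⟩ := hf
  exact ((integrable_exp_norm_of_gaussian hV c).const_mul C).mono' hm (.of_forall fun ω => hf _)

lemma ExpGrowth.memLp_two {V : Ω → E} (hV : HasGaussianLaw V P) {f : E → F} (hf : ExpGrowth f)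
    (hm : AEStronglyMeasurable (fun ω => f (V ω)) P) : MemLp (fun ω => f (V ω)) 2 P := by
  rw [memLp_two_iff_integrable_sq_norm hm]
  have h : ExpGrowth (fun x => ‖f x‖ ^ 2) := (hf.of_norm_le fun x => by simp).pow 2
  exact h.integrable hV (hm.norm.pow 2)

/-- Stein's lemma for a centered real Gaussian variable. -/
lemma stein_gaussianReal {v : NNReal} (hv : v ≠ 0) {f f' : ℝ → ℝ}
    (hd : ∀ x, HasDerivAt f (f' x) x) (hf' : Continuous f')
    (gf : ExpGrowth f) (gf' : ExpGrowth f') :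
    ∫ x, x * f x ∂(gaussianReal 0 v) = v * ∫ x, f' x ∂(gaussianReal 0 v) := by
  have hcf : Continuous f := continuous_iff_continuousAt.2 fun x => (hd x).continuousAt
  have hid : HasGaussianLaw (id : ℝ → ℝ) (gaussianReal 0 v) := IsGaussian.hasGaussianLaw_id
  have key : ∀ g : ℝ → ℝ, ExpGrowth g → Continuous g →
      Integrable (fun x => gaussianPDFReal 0 v x * g x) := by
    intro g hg hgc
    have h1 : Integrable g (gaussianReal 0 v) := hg.integrable hid hgc.aestronglyMeasurable
    rw [gaussianReal_of_var_ne_zero _ hv, integrable_withDensity_iff_integrable_smul'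
      (measurable_gaussianPDF _ _) (.of_forall fun x => gaussianPDF_lt_top)] at h1
    simpa using h1
  rw [integral_gaussianReal_eq_integral_smul hv, integral_gaussianReal_eq_integral_smul hv]
  -- The density `p` satisfies `x p(x) = -v p'(x)`, so the lemma is integration by parts on the
  -- line; exponential growth makes the three products integrable.
  have hpdf : ∀ x, HasDerivAt (gaussianPDFReal 0 v) (-(x / v) * gaussianPDFReal 0 v x) x := by
    intro x
    have h := ((((hasDerivAt_id x).sub_const 0).pow 2).neg.div_const (2 * (v : ℝ))).exp.const_mul
      (√(2 * Real.pi * v))⁻¹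
    have hv' : (v : ℝ) ≠ 0 := by simpa using hv
    convert! h using 1
    simp only [gaussianPDFReal, id, Pi.pow_apply, Pi.neg_apply]
    field_simp
    simp [mul_comm]
  have hv' : (v : ℝ) ≠ 0 := by simpa using hv
  have := integral_mul_deriv_eq_deriv_mul_of_integrable (u := f) (u' := f')
    (v := gaussianPDFReal 0 v) (v' := fun x => -(x / v) * gaussianPDFReal 0 v x)
    (fun x _ => hd x) (fun x _ => hpdf x)
    (by
      have := (key (fun x => x * f x) (expGrowth_id.mul gf) (by fun_prop)).const_mul (-(1 / (v:ℝ)))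
      refine this.congr (.of_forall fun x => ?_)
      simp only [Pi.mul_apply]; field_simp)
    (by
      refine (key f' gf' hf').congr (.of_forall fun x => ?_)
      simp only [Pi.mul_apply]; ring)
    (by
      refine (key f gf hcf).congr (.of_forall fun x => ?_)
      simp only [Pi.mul_apply]; ring)
  simp only [smul_eq_mul]
  calc ∫ x, gaussianPDFReal 0 v x * (x * f x)
      = ∫ x, -(v : ℝ) * (f x * (-(x / v) * gaussianPDFReal 0 v x)) := by
        congr 1; ext x; field_simp
    _ = v * ∫ x, f' x * gaussianPDFReal 0 v x := by
        rw [integral_const_mul, this]; ring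
    _ = _ := by congr 2; ext x; ring

/-- Gaussian integration by parts: if `(Y, V)` is Gaussian and `Y` is centered then
`E[Y f(V)] = E[f'(V) c]` with `c = E[Y V]`. -/
lemma gaussian_ibp {Y : Ω → ℝ} {V : Ω → E} (h : HasGaussianLaw (fun ω => (Y ω, V ω)) P)
    (hY : ∫ ω, Y ω ∂P = 0) {f : E → ℝ} (hf : ContDiff ℝ 1 f)
    (gf : ExpGrowth f) (gf' : ExpGrowth (fderiv ℝ f)) :
    ∫ ω, Y ω * f (V ω) ∂P = ∫ ω, fderiv ℝ f (V ω) (∫ ω', Y ω' • V ω' ∂P) ∂P := by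
  have hP := h.isProbabilityMeasure
  have hYg : HasGaussianLaw Y P := h.fst
  have hVg : HasGaussianLaw V P := h.snd
  have hY2 : MemLp Y 2 P := hYg.memLp_two
  have hV2 : MemLp V 2 P := hVg.memLp_two
  have hYV : Integrable (fun ω => Y ω • V ω) P :=
    memLp_one_iff_integrable.1 (hV2.smul (r := 1) hY2)
  set c := ∫ ω', Y ω' • V ω' ∂P with hc
  set s : ℝ := ∫ ω, Y ω ^ 2 ∂P with hs
  have hvar : Var[Y; P] = s := by rw [variance_eq_integral hYg.aemeasurable, hY]; simp [hs]
  -- If `Y` has zero variance it vanishes almost surely, hence so does `c`, and both sides are zero.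
  -- Otherwise one may divide by `s`.
  by_cases hs0 : s = 0
  · have hY0 : Y =ᵐ[P] 0 := by
      have := (integral_eq_zero_iff_of_nonneg (fun ω => sq_nonneg (Y ω)) hY2.integrable_sq).1 hs0
      filter_upwards [this] with ω hω using by simpa using hω
    have hc0 : c = 0 := by
      rw [hc]; refine integral_eq_zero_of_ae ?_
      filter_upwards [hY0] with ω hω using by simp [hω]
    rw [hc0]; simp only [map_zero, integral_zero]
    refine integral_eq_zero_of_ae ?_
    filter_upwards [hY0] with ω hω using by simp [hω]
  -- Regression of `V` on `Y`: the residual `W = V - Y a` is uncorrelated with `Y`, hence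
  -- independent of it by joint Gaussianity.
  set a := s⁻¹ • c with ha
  set W : Ω → E := fun ω => V ω - Y ω • a with hW
  set v : NNReal := s.toNNReal with hv
  have hs_nonneg : 0 ≤ s := integral_nonneg fun ω => sq_nonneg _
  have hvs : (v : ℝ) = s := Real.coe_toNNReal _ hs_nonneg
  have hv0 : v ≠ 0 := by
    intro h0; rw [h0] at hvs; exact hs0 (by simpa using hvs.symm)
  have hYW : HasGaussianLaw (fun ω => (Y ω, W ω)) P := h.map_fun
    ((ContinuousLinearMap.fst ℝ ℝ E).prod
      (ContinuousLinearMap.snd ℝ ℝ E - (ContinuousLinearMap.fst ℝ ℝ E).smulRight a))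
  have hWg : HasGaussianLaw W P := hYW.snd
  have hind : IndepFun Y W P := by
    refine hYW.indepFun_of_covariance_strongDual fun L₁ L₂ => ?_
    have hL1 : ∀ y : ℝ, L₁ y = y * L₁ 1 := fun y => by
      rw [← smul_eq_mul, ← map_smul]; simp
    have e1 : L₁ ∘ Y = fun ω => L₁ 1 * Y ω := by ext ω; simp [hL1 (Y ω), mul_comm]
    have hLW : MemLp (L₂ ∘ W) 2 P := (hWg.map L₂).memLp_two
    rw [e1, covariance_const_mul_left, covariance_eq_sub hY2 hLW, hY]
    have e2 : ∫ ω, (Y * (L₂ ∘ W)) ω ∂P = 0 := by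
      have e3 : (fun ω => (Y * (L₂ ∘ W)) ω) =
          fun ω => L₂ (Y ω • V ω) - Y ω ^ 2 * L₂ a := by
        ext ω; simp [hW, map_sub]; ring
      rw [e3, integral_sub (L₂.integrable_comp hYV) (hY2.integrable_sq.mul_const _),
        L₂.integral_comp_comm hYV, integral_mul_const, ← hc, ← hs, ha]
      simp; field_simp; simp
    rw [e2]; simp
  have hlaw := (indepFun_iff_map_prod_eq_prod_map_map hYg.aemeasurable hWg.aemeasurable).1 hind
  have hmapY : P.map Y = gaussianReal 0 v := by
    rw [hYg.map_eq_gaussianReal, hY, hvar]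
  rw [hmapY] at hlaw
  have hWprob : IsProbabilityMeasure (P.map W) := Measure.isProbabilityMeasure_map hWg.aemeasurable
  have hVeq : ∀ ω, V ω = Y ω • a + W ω := fun ω => by simp [hW]
  have hcf := hf.continuous
  have hcf' := hf.continuous_fderiv one_ne_zero
  have int1 : Integrable (fun ω => Y ω * f (V ω)) P := by
    refine (gf.memLp_two hVg ?_).integrable_mul hY2 |>.congr (.of_forall fun ω => ?_)
    · exact (hcf.measurable.comp_aemeasurable hVg.aemeasurable).aestronglyMeasurable
    · simp [mul_comm]
  have int2 : Integrable (fun ω => fderiv ℝ f (V ω) c) P := by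
    refine (gf'.clm_comp_apply c).integrable hVg ?_
    exact ((by fun_prop : Continuous fun x => fderiv ℝ f x c).measurable.comp_aemeasurable
      hVg.aemeasurable).aestronglyMeasurable
  have m1 : Continuous (fun p : ℝ × E => p.1 * f (p.1 • a + p.2)) := by fun_prop
  have m2 : Continuous (fun p : ℝ × E => fderiv ℝ f (p.1 • a + p.2) c) := by fun_prop
  have q1 : ∫ ω, Y ω * f (V ω) ∂P =
      ∫ p, p.1 * f (p.1 • a + p.2) ∂((gaussianReal 0 v).prod (P.map W)) := by
    rw [← hlaw, integral_map hYW.aemeasurable m1.measurable.aestronglyMeasurable]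
    simp_rw [hVeq]
  have q2 : ∫ ω, fderiv ℝ f (V ω) c ∂P =
      ∫ p, fderiv ℝ f (p.1 • a + p.2) c ∂((gaussianReal 0 v).prod (P.map W)) := by
    rw [← hlaw, integral_map hYW.aemeasurable m2.measurable.aestronglyMeasurable]
    simp_rw [hVeq]
  have i1 : Integrable (fun p : ℝ × E => p.1 * f (p.1 • a + p.2))
      ((gaussianReal 0 v).prod (P.map W)) := by
    rw [← hlaw, integrable_map_measure m1.measurable.aestronglyMeasurable hYW.aemeasurable]
    refine int1.congr (.of_forall fun ω => ?_)
    simp only [Function.comp, ← hVeq]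
  have i2 : Integrable (fun p : ℝ × E => fderiv ℝ f (p.1 • a + p.2) c)
      ((gaussianReal 0 v).prod (P.map W)) := by
    rw [← hlaw, integrable_map_measure m2.measurable.aestronglyMeasurable hYW.aemeasurable]
    refine int2.congr (.of_forall fun ω => ?_)
    simp only [Function.comp, ← hVeq]
  -- With the residual frozen at `w`, the one-dimensional lemma applies to `y ↦ f(y a + w)`; its
  -- factor `s` turns the direction `a` into `c`.
  rw [q1, q2, integral_prod_symm _ i1, integral_prod_symm _ i2]
  congr 1; ext w
  have bd : ∀ y : ℝ, ‖y • a + w‖ ≤ ‖w‖ + ‖a‖ * ‖y‖ := fun y => by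
    have := norm_add_le (y • a) w
    rw [norm_smul] at this; linarith
  have hsc : s • a = c := by rw [ha, smul_smul, mul_inv_cancel₀ hs0, one_smul]
  rw [stein_gaussianReal hv0 (f := fun y => f (y • a + w))
    (f' := fun y => fderiv ℝ f (y • a + w) a), hvs, ← integral_const_mul]
  · congr 1; ext y
    have := congrArg (fderiv ℝ f (y • a + w)) hsc
    rw [map_smul, smul_eq_mul] at this
    exact this
  · intro y
    have h1 : HasDerivAt (fun y : ℝ => y • a + w) a y := by
      simpa using ((hasDerivAt_id y).smul_const a).add_const w
    exact ((hf.differentiable one_ne_zero _).hasFDerivAt).comp_hasDerivAt y h1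
  · fun_prop
  · exact gf.comp_lipschitz (norm_nonneg a) bd
  · exact (gf'.clm_comp_apply a).comp_lipschitz (norm_nonneg a) bd

end IBP

/-! ### Tame functions: an algebra stable under smooth Lipschitz maps -/

section Tame

variable {E F : Type*} [NormedAddCommGroup E] [NormedSpace ℝ E] [NormedAddCommGroup F]
  [NormedSpace ℝ F]

/-- A smooth function which, together with its derivative, grows at most exponentially. -/
structure IsTame (f : E → ℝ) : Prop where
  contDiff : ContDiff ℝ ((⊤ : ℕ∞) : WithTop ℕ∞) f
  growth : ExpGrowth f
  growth_fderiv : ExpGrowth (fderiv ℝ f)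

namespace IsTame

variable {f g : E → ℝ}

lemma differentiable (hf : IsTame f) : Differentiable ℝ f := hf.contDiff.differentiable (by simp)

lemma continuous (hf : IsTame f) : Continuous f := hf.contDiff.continuous

lemma contDiff_one (hf : IsTame f) : ContDiff ℝ 1 f := hf.contDiff.of_le (by simp)

lemma continuous_fderiv (hf : IsTame f) : Continuous (fderiv ℝ f) :=
  hf.contDiff_one.continuous_fderiv one_ne_zero

lemma const (a : ℝ) : IsTame (fun _ : E => a) :=
  ⟨contDiff_const, .const a, by
    have : fderiv ℝ (fun _ : E => a) = fun _ => 0 := by ext1 x; exact fderiv_const_apply a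
    rw [this]; exact .const 0⟩

lemma clm (L : E →L[ℝ] ℝ) : IsTame (fun x => L x) :=
  ⟨L.contDiff, expGrowth_clm L, by
    have : fderiv ℝ (fun x => L x) = fun _ => L := by ext1 x; exact L.fderiv
    rw [this]; exact .const L⟩

lemma add (hf : IsTame f) (hg : IsTame g) : IsTame (fun x => f x + g x) :=
  ⟨hf.contDiff.add hg.contDiff, hf.growth.add hg.growth, by
    have : fderiv ℝ (fun x => f x + g x) = fun x => fderiv ℝ f x + fderiv ℝ g x := by
      ext1 x; exact fderiv_fun_add (hf.differentiable x) (hg.differentiable x)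
    rw [this]; exact hf.growth_fderiv.add hg.growth_fderiv⟩

lemma mul (hf : IsTame f) (hg : IsTame g) : IsTame (fun x => f x * g x) :=
  ⟨hf.contDiff.mul hg.contDiff, hf.growth.mul hg.growth, by
    have : fderiv ℝ (fun x => f x * g x) = fun x => f x • fderiv ℝ g x + g x • fderiv ℝ f x := by
      ext1 x; exact fderiv_fun_mul (hf.differentiable x) (hg.differentiable x)
    rw [this]
    exact (hf.growth.smul hg.growth_fderiv).add (hg.growth.smul hf.growth_fderiv)⟩

lemma comp_clm (hf : IsTame f) (L : F →L[ℝ] E) : IsTame (fun x => f (L x)) :=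
  ⟨hf.contDiff.comp L.contDiff, hf.growth.comp_clm L, by
    have : fderiv ℝ (fun x => f (L x)) = fun x => (fderiv ℝ f (L x)).comp L := by
      ext1 x
      exact ((hf.differentiable (L x)).hasFDerivAt.comp x L.hasFDerivAt).fderiv
    rw [this]
    exact (hf.growth_fderiv.comp_clm L).of_norm_le_mul (.const L)
      fun x => ContinuousLinearMap.opNorm_comp_le _ _⟩

/-- Composition with a smooth function of bounded derivative. -/
lemma comp (hf : IsTame f) {k : ℝ → ℝ} (hk : ContDiff ℝ ((⊤ : ℕ∞) : WithTop ℕ∞) k) {K : ℝ}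
    (hK : ∀ x, |_root_.deriv k x| ≤ K) : IsTame (fun x => k (f x)) := by
  have hd : Differentiable ℝ k := hk.differentiable (by simp)
  have hK0 : 0 ≤ K := (abs_nonneg _).trans (hK 0)
  refine ⟨hk.comp hf.contDiff, ?_, ?_⟩
  · have h := (ExpGrowth.const (E := E) |k 0|).add ((ExpGrowth.const (E := E) K).mul
      (hf.growth.of_norm_le (g := fun x => |f x|) fun x => by simp))
    refine h.of_norm_le fun x => ?_
    have h1 := Convex.norm_image_sub_le_of_norm_deriv_le (f := k) (C := K) (s := Set.univ)
      (fun x _ => hd x) (fun x _ => hK x) convex_univ (Set.mem_univ 0) (Set.mem_univ (f x))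
    simp only [Real.norm_eq_abs, sub_zero] at h1 ⊢
    have h2 : |k (f x)| ≤ |k 0| + |k (f x) - k 0| := by
      have := abs_add_le (k 0) (k (f x) - k 0); simpa using this
    exact (by linarith : _ ≤ _).trans (le_abs_self _)
  · have : fderiv ℝ (fun x => k (f x)) = fun x => _root_.deriv k (f x) • fderiv ℝ f x := by
      ext1 x
      exact ((hd (f x)).hasDerivAt.comp_hasFDerivAt x (hf.differentiable x).hasFDerivAt).fderiv
    rw [this]
    refine ((ExpGrowth.const K).smul hf.growth_fderiv).of_norm_le fun x => ?_
    rw [norm_smul, norm_smul, Real.norm_eq_abs, Real.norm_eq_abs, abs_of_nonneg hK0]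
    gcongr; exact hK _

lemma fderiv_comp (hf : IsTame f) {k : ℝ → ℝ} (hk : ContDiff ℝ ((⊤ : ℕ∞) : WithTop ℕ∞) k) (x : E) :
    fderiv ℝ (fun x => k (f x)) x = _root_.deriv k (f x) • fderiv ℝ f x :=
  (((hk.differentiable (by simp)) (f x)).hasDerivAt.comp_hasFDerivAt x
    (hf.differentiable x).hasFDerivAt).fderiv

lemma of_hasCompactSupport (hf : ContDiff ℝ ((⊤ : ℕ∞) : WithTop ℕ∞) f)
    (hs : HasCompactSupport f) : IsTame f := by
  obtain ⟨C, hC⟩ := hf.continuous.bounded_above_of_compact_support hs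
  obtain ⟨D, hD⟩ := (hf.continuous_fderiv (by simp)).bounded_above_of_compact_support
    (hs.fderiv ℝ)
  exact ⟨hf, .of_bound C hC, .of_bound D hD⟩

lemma polynomial (p : Polynomial ℝ) : IsTame (fun x : ℝ => p.eval x) := by
  induction p using Polynomial.induction_on with
  | C a => simpa using IsTame.const a
  | add p q hp hq => simpa using hp.add hq
  | monomial n a ih =>
    have h := ih.mul (IsTame.clm (ContinuousLinearMap.id ℝ ℝ))
    simpa [pow_succ, mul_assoc] using h

end IsTame

end Tame

/-! ### Inner products and dominated convergence in L² -/

section Lp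

variable {Ω E : Type*} [MeasurableSpace Ω] {P : Measure Ω} [NormedAddCommGroup E]
  [InnerProductSpace ℝ E]

lemma inner_toLp_toLp {f g : Ω → E} (hf : MemLp f 2 P) (hg : MemLp g 2 P) :
    inner ℝ (hf.toLp f) (hg.toLp g) = ∫ ω, inner ℝ (f ω) (g ω) ∂P := by
  rw [L2.inner_def]
  refine integral_congr_ae ?_
  filter_upwards [hf.coeFn_toLp, hg.coeFn_toLp] with ω h1 h2 using by rw [h1, h2]

lemma inner_toLp_right (f : Lp E 2 P) {g : Ω → E} (hg : MemLp g 2 P) :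
    inner ℝ f (hg.toLp g) = ∫ ω, inner ℝ (f ω) (g ω) ∂P := by
  rw [L2.inner_def]
  refine integral_congr_ae ?_
  filter_upwards [hg.coeFn_toLp] with ω h2 using by rw [h2]

lemma tendsto_toLp_of_dominated {f : ℕ → Ω → E} {g : Ω → E} {b : Ω → ℝ}
    (hf : ∀ n, MemLp (f n) 2 P) (hg : MemLp g 2 P) (hb : MemLp b 2 P)
    (hbd : ∀ n, ∀ᵐ ω ∂P, ‖f n ω‖ ≤ b ω)
    (hlim : ∀ᵐ ω ∂P, Tendsto (fun n => f n ω) atTop (𝓝 (g ω))) :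
    Tendsto (fun n => (hf n).toLp (f n)) atTop (𝓝 (hg.toLp g)) := by
  rw [tendsto_iff_norm_sub_tendsto_zero]
  have h1 : ∀ n, ‖(hf n).toLp (f n) - hg.toLp g‖ ^ 2 = ∫ ω, ‖f n ω - g ω‖ ^ 2 ∂P := by
    intro n
    rw [← MemLp.toLp_sub, ← real_inner_self_eq_norm_sq, inner_toLp_toLp]
    simp
  have hgb : ∀ᵐ ω ∂P, ‖g ω‖ ≤ b ω := by
    filter_upwards [hlim, ae_all_iff.2 hbd] with ω h2 h3
    exact le_of_tendsto' h2.norm h3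
  have h2 : Tendsto (fun n => ∫ ω, ‖f n ω - g ω‖ ^ 2 ∂P) atTop (𝓝 (∫ _, (0 : ℝ) ∂P)) := by
    refine tendsto_integral_of_dominated_convergence (fun ω => 4 * b ω ^ 2) (fun n => ?_)
      (hb.integrable_sq.const_mul 4) (fun n => ?_) ?_
    · exact (((hf n).1.sub hg.1).norm.pow 2)
    · filter_upwards [hbd n, hgb] with ω h3 h4
      have h5 : ‖f n ω - g ω‖ ≤ 2 * b ω := (norm_sub_le _ _).trans (by linarith)
      have h6 := norm_nonneg (f n ω - g ω)
      rw [Real.norm_eq_abs, abs_of_nonneg (by positivity)]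
      nlinarith
    · filter_upwards [hlim] with ω h3
      have := ((tendsto_iff_norm_sub_tendsto_zero.1 h3).pow 2)
      simpa using this
  simp only [integral_zero, ← h1] at h2
  have := h2.sqrt
  simpa [Real.sqrt_sq] using this

end Lp

/-! ### Cylindrical variables given by tame functions -/

section Cylinder

variable {Ω H : Type*} [MeasurableSpace Ω] [NormedAddCommGroup H] [InnerProductSpace ℝ H]
  {X : H → Ω → ℝ} {P : Measure Ω}

/-- The vector `(X(φ₁), …, X(φₙ))`. -/
def evalAt (X : H → Ω → ℝ) {n : ℕ} (φ : Fin n → H) : Ω → Fin n → ℝ := fun ω i => X (φ i) ω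

/-- The vector `∑ᵢ L(eᵢ) φᵢ` associated to a linear form `L` on `ℝⁿ`. -/
def pullback {n : ℕ} (φ : Fin n → H) : ((Fin n → ℝ) →L[ℝ] ℝ) →L[ℝ] H :=
  ∑ i, (ContinuousLinearMap.apply ℝ ℝ (Pi.single i (1 : ℝ) : Fin n → ℝ)).smulRight (φ i)

lemma pullback_apply {n : ℕ} (φ : Fin n → H) (L : (Fin n → ℝ) →L[ℝ] ℝ) :
    pullback φ L = ∑ i, L (Pi.single i 1) • φ i := by
  simp [pullback]

/-- Pairing a Malliavin gradient with `h` is thus a directional derivative along `(⟨h, φᵢ⟩)ᵢ`, which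
is exactly the vector `E[X(h) X(φᵢ)]` appearing in Gaussian integration by parts. -/
lemma inner_pullback {n : ℕ} (φ : Fin n → H) (L : (Fin n → ℝ) →L[ℝ] ℝ) (h : H) :
    inner ℝ (pullback φ L) h = L (fun i => inner ℝ h (φ i)) := by
  rw [pullback_apply, sum_inner]
  conv_rhs => rw [← Finset.univ_sum_single (fun i => inner ℝ h (φ i)), map_sum]
  refine Finset.sum_congr rfl fun i _ => ?_
  have : (Pi.single i (inner ℝ h (φ i)) : Fin n → ℝ) = inner ℝ h (φ i) • Pi.single i 1 := by
    rw [← Pi.single_smul]; simp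
  rw [this, map_smul, real_inner_smul_left, real_inner_comm, smul_eq_mul, mul_comm]

lemma measurable_evalAt (hX : IsIsonormal X P) {n : ℕ} (φ : Fin n → H) :
    Measurable (evalAt X φ) := measurable_pi_lambda _ fun i => hX.measurable (φ i)

lemma hasGaussianLaw_pair (hX : IsIsonormal X P) {n : ℕ} (h : H) (φ : Fin n → H) :
    HasGaussianLaw (fun ω => (X h ω, evalAt X φ ω)) P := by
  classical
  let I : Finset H := insert h (Finset.univ.image φ)
  let L : (I → ℝ) →L[ℝ] ℝ × (Fin n → ℝ) :=
    (ContinuousLinearMap.proj (R := ℝ) (φ := fun _ : I => ℝ) ⟨h, by simp [I]⟩).prod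
      (ContinuousLinearMap.pi fun i =>
        ContinuousLinearMap.proj (R := ℝ) (φ := fun _ : I => ℝ) ⟨φ i, by simp [I]⟩)
  exact (hX.gaussian.hasGaussianLaw I).map_fun L

lemma hasGaussianLaw_evalAt (hX : IsIsonormal X P) {n : ℕ} (φ : Fin n → H) :
    HasGaussianLaw (evalAt X φ) P := (hasGaussianLaw_pair hX 0 φ).snd

lemma memLp_cyl (hX : IsIsonormal X P) {n : ℕ} (φ : Fin n → H) {F : Type*} [NormedAddCommGroup F]
    {f : (Fin n → ℝ) → F} (hf : Continuous f) (gf : ExpGrowth f) :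
    MemLp (fun ω => f (evalAt X φ ω)) 2 P :=
  gf.memLp_two (hasGaussianLaw_evalAt hX φ)
    (hf.comp_aestronglyMeasurable (measurable_evalAt hX φ).aestronglyMeasurable)

lemma memLp_mul_cyl (hX : IsIsonormal X P) (h : H) {n : ℕ} (φ : Fin n → H)
    {f : (Fin n → ℝ) → ℝ} (hf : Continuous f) (gf : ExpGrowth f) :
    MemLp (fun ω => X h ω * f (evalAt X φ ω)) 2 P := by
  have hg : ExpGrowth (fun p : ℝ × (Fin n → ℝ) => p.1 * f p.2) :=
    (expGrowth_clm (ContinuousLinearMap.fst ℝ ℝ (Fin n → ℝ))).mul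
      (gf.comp_clm (ContinuousLinearMap.snd ℝ ℝ (Fin n → ℝ)))
  have hc : Continuous (fun p : ℝ × (Fin n → ℝ) => p.1 * f p.2) := by fun_prop
  exact hg.memLp_two (hasGaussianLaw_pair hX h φ) (hc.comp_aestronglyMeasurable
    ((hX.measurable h).prodMk (measurable_evalAt hX φ)).aestronglyMeasurable)

lemma memLp_grad (hX : IsIsonormal X P) {n : ℕ} (φ : Fin n → H)
    {f : (Fin n → ℝ) → ℝ} (hf : IsTame f) :
    MemLp (fun ω => pullback φ (fderiv ℝ f (evalAt X φ ω))) 2 P :=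
  memLp_cyl hX φ (f := fun x => pullback φ (fderiv ℝ f x))
    ((pullback φ).continuous.comp hf.continuous_fderiv) (hf.growth_fderiv.clm_comp (pullback φ))

/-- The random variable `f(X(φ₁), …, X(φₙ))` together with its Malliavin derivative. -/
def cylPair (hX : IsIsonormal X P) {n : ℕ} (φ : Fin n → H) {f : (Fin n → ℝ) → ℝ} (hf : IsTame f) :
    Lp ℝ 2 P × Lp H 2 P :=
  ((memLp_cyl hX φ hf.continuous hf.growth).toLp _, (memLp_grad hX φ hf).toLp _)

lemma isSmoothCylinder_cylPair (hX : IsIsonormal X P) {n : ℕ} (hn : 1 ≤ n) (φ : Fin n → H)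
    {f : (Fin n → ℝ) → ℝ} (hf : IsTame f) (hs : HasCompactSupport f) :
    IsSmoothCylinder X P (cylPair hX φ hf).1 (cylPair hX φ hf).2 := by
  refine ⟨n, f, φ, hn, hf.contDiff, hs,
    (memLp_cyl hX φ hf.continuous hf.growth).coeFn_toLp, ?_⟩
  filter_upwards [(memLp_grad hX φ hf).coeFn_toLp] with ω hω
  simp only [cylPair]
  rw [hω, pullback_apply]; rfl

lemma IsSmoothCylinder.eq_cylPair (hX : IsIsonormal X P) {F : Lp ℝ 2 P} {u : Lp H 2 P}
    (h : IsSmoothCylinder X P F u) : ∃ (n : ℕ) (φ : Fin n → H) (f : (Fin n → ℝ) → ℝ)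
      (hf : IsTame f), 1 ≤ n ∧ HasCompactSupport f ∧ (F, u) = cylPair hX φ hf := by
  obtain ⟨n, f, φ, hn, hf, hs, hF, hu⟩ := h
  have ht := IsTame.of_hasCompactSupport hf hs
  refine ⟨n, φ, f, ht, hn, hs, Prod.ext ?_ ?_⟩
  · exact Lp.ext (hF.trans (memLp_cyl hX φ ht.continuous ht.growth).coeFn_toLp.symm)
  · refine Lp.ext ?_
    filter_upwards [hu, (memLp_grad hX φ ht).coeFn_toLp] with ω h1 h2
    simp only [cylPair]
    rw [h1, h2, pullback_apply]; rfl

lemma isClosed_derivGraph : IsClosed (derivGraph X P : Set (Lp ℝ 2 P × Lp H 2 P)) :=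
  Submodule.isClosed_topologicalClosure _

/-- Cylindrical variables given by tame functions are in the domain of the derivative. -/
lemma cylPair_mem_derivGraph (hX : IsIsonormal X P) {n : ℕ} (hn : 1 ≤ n) (φ : Fin n → H)
    {f : (Fin n → ℝ) → ℝ} (hf : IsTame f) : cylPair hX φ hf ∈ derivGraph X P := by
  let χ : ContDiffBump (0 : Fin n → ℝ) := ⟨1, 2, one_pos, one_lt_two⟩
  have hχc : ContDiff ℝ ((⊤ : ℕ∞) : WithTop ℕ∞) χ := χ.contDiff
  have hχ : IsTame (χ : (Fin n → ℝ) → ℝ) := .of_hasCompactSupport hχc χ.hasCompactSupport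
  obtain ⟨C, hC⟩ := hχ.continuous_fderiv.bounded_above_of_compact_support
    (χ.hasCompactSupport.fderiv ℝ)
  have hC0 : 0 ≤ C := (norm_nonneg _).trans (hC 0)
  -- The approximants are `χ(r x) f(x)` with `r → 0`. Their gradient differs from that of `f` by a
  -- term carrying a factor `r`; the bound `r ≤ 1` gives a dominating function independent of `k`.
  let r : ℕ → ℝ := fun k => ((k : ℝ) + 1)⁻¹
  have hr0 : ∀ k, 0 < r k := fun k => by positivity
  have hr1 : ∀ k, r k ≤ 1 := fun k => inv_le_one_of_one_le₀ (by simp)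
  have hrlim : Tendsto r atTop (𝓝 0) := by
    simpa [r, one_div] using tendsto_one_div_add_atTop_nhds_zero_nat (𝕜 := ℝ)
  let Lk : ℕ → (Fin n → ℝ) →L[ℝ] (Fin n → ℝ) := fun k => r k • ContinuousLinearMap.id ℝ _
  have hLk : ∀ k x, Lk k x = r k • x := fun k x => by simp [Lk]
  let g : ℕ → (Fin n → ℝ) → ℝ := fun k x => χ (Lk k x) * f x
  have hg : ∀ k, IsTame (g k) := fun k => (hχ.comp_clm (Lk k)).mul hf
  have hgs : ∀ k, HasCompactSupport (g k) := fun k => by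
    have h1 : HasCompactSupport (fun x => χ (Lk k x)) := by
      have := χ.hasCompactSupport.comp_homeomorph (Homeomorph.smulOfNeZero (r k) (hr0 k).ne')
      have e : (fun x => χ (Lk k x)) = χ ∘ Homeomorph.smulOfNeZero (r k) (hr0 k).ne' := by
        ext x; simp [hLk]
      rw [e]
      exact this
    exact h1.mul_right
  have hlim0 : ∀ x : Fin n → ℝ, ∀ᶠ k in atTop, ‖Lk k x‖ < 1 := by
    intro x
    have h1 : Tendsto (fun k => ‖Lk k x‖) atTop (𝓝 0) := by
      have := (hrlim.smul_const x).norm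
      simpa [hLk] using this
    exact h1.eventually_lt_const one_pos
  have hlim1 : ∀ x, ∀ᶠ k in atTop, χ (Lk k x) = 1 := fun x => by
    filter_upwards [hlim0 x] with k hk
    exact χ.one_of_mem_closedBall (by simpa [χ] using hk.le)
  have hfd : ∀ k x, fderiv ℝ (g k) x =
      χ (Lk k x) • fderiv ℝ f x + f x • (r k • fderiv ℝ χ (Lk k x)) := by
    intro k x
    have h1 : HasFDerivAt (fun x => χ (Lk k x)) ((fderiv ℝ χ (Lk k x)).comp (Lk k)) x :=
      (hχ.differentiable _).hasFDerivAt.comp x (Lk k).hasFDerivAt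
    have h2 := (h1.mul (hf.differentiable x).hasFDerivAt).fderiv
    have h3 : (fderiv ℝ χ (Lk k x)).comp (Lk k) = r k • fderiv ℝ χ (Lk k x) := by
      ext y; simp [hLk]
    rw [h3] at h2; exact h2
  refine isClosed_derivGraph.mem_of_tendsto (f := fun k => cylPair hX φ (hg k)) (b := atTop) ?_
    (.of_forall fun k => Submodule.le_topologicalClosure _ (Submodule.subset_span
      (isSmoothCylinder_cylPair hX hn φ (hg k) (hgs k))))
  refine Tendsto.prodMk_nhds ?_ ?_
  · refine tendsto_toLp_of_dominated (b := fun ω => |f (evalAt X φ ω)|) _ _ ?_ ?_ ?_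
    · exact (memLp_cyl hX φ hf.continuous hf.growth).abs
    · refine fun k => .of_forall fun ω => ?_
      simp only [g, norm_mul, Real.norm_eq_abs, abs_of_nonneg χ.nonneg]
      exact mul_le_of_le_one_left (abs_nonneg _) χ.le_one
    · refine .of_forall fun ω => tendsto_const_nhds.congr' ?_
      filter_upwards [hlim1 (evalAt X φ ω)] with k hk
      simp [g, hk]
  · refine tendsto_toLp_of_dominated
      (b := fun ω => ‖pullback φ‖ * (‖fderiv ℝ f (evalAt X φ ω)‖ + C * ‖f (evalAt X φ ω)‖))
      _ _ ?_ ?_ ?_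
    · refine memLp_cyl hX φ (f := fun x => ‖pullback φ‖ * (‖fderiv ℝ f x‖ + C * ‖f x‖)) ?_ ?_
      · have := hf.continuous_fderiv; have := hf.continuous; fun_prop
      · exact (ExpGrowth.const _).mul ((hf.growth_fderiv.of_norm_le fun x => by simp).add
          ((ExpGrowth.const C).mul (hf.growth.of_norm_le fun x => by simp)))
    · refine fun k => .of_forall fun ω => ((pullback φ).le_opNorm _).trans ?_
      gcongr
      rw [hfd]
      refine (norm_add_le _ _).trans ?_
      rw [norm_smul, norm_smul, norm_smul, Real.norm_of_nonneg χ.nonneg,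
        Real.norm_of_nonneg (hr0 k).le]
      have e1 := mul_le_of_le_one_left (norm_nonneg (fderiv ℝ f (evalAt X φ ω)))
        (χ.le_one (x := Lk k (evalAt X φ ω)))
      have e2 : r k * ‖fderiv ℝ χ (Lk k (evalAt X φ ω))‖ ≤ C :=
        (mul_le_of_le_one_left (norm_nonneg _) (hr1 k)).trans (hC _)
      have e3 := mul_le_mul_of_nonneg_left e2 (norm_nonneg (f (evalAt X φ ω)))
      linarith
    · refine .of_forall fun ω => ((pullback φ).continuous.tendsto _).comp ?_
      simp only [hfd]
      set x := evalAt X φ ω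
      have e1 : Tendsto (fun k => χ (Lk k x) • fderiv ℝ f x) atTop (𝓝 (fderiv ℝ f x)) := by
        refine tendsto_const_nhds.congr' ?_
        filter_upwards [hlim1 x] with k hk
        simp [hk]
      have e2 : Tendsto (fun k => f x • (r k • fderiv ℝ χ (Lk k x))) atTop (𝓝 0) := by
        have e3 : Tendsto (fun k => r k • fderiv ℝ χ (Lk k x)) atTop (𝓝 0) := by
          refine squeeze_zero_norm (a := fun k => r k * C) (fun k => ?_)
            (by simpa using hrlim.mul_const C)
          rw [norm_smul, Real.norm_of_nonneg (hr0 k).le]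
          exact mul_le_mul_of_nonneg_left (hC _) (hr0 k).le
        simpa using e3.const_smul (f x)
      simpa using e1.add e2

end Cylinder

/-! ### A density argument in Hilbert space -/

section Hilbert

/-- The orthogonal complement of `x` is closed and contains `S`, so it contains `x` itself. -/
lemma eq_zero_of_mem_closure_span {A : Type*} [NormedAddCommGroup A] [InnerProductSpace ℝ A]
    {S : Set A} {x : A} (hx : x ∈ (Submodule.span ℝ S).topologicalClosure)
    (h : ∀ s ∈ S, inner ℝ s x = 0) : x = 0 := by
  have h1 : (Submodule.span ℝ S).topologicalClosure ≤ LinearMap.ker (innerSL ℝ x).toLinearMap := by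
    refine Submodule.topologicalClosure_minimal _ (Submodule.span_le.2 fun s hs => ?_)
      (innerSL ℝ x).isClosed_ker
    simpa [real_inner_comm] using h s hs
  have h2 := h1 hx
  simpa using h2

end Hilbert

/-! ### The closed graph of the derivative: integration by parts, closability, chain rule -/

section Graph

variable {Ω H : Type*} [MeasurableSpace Ω] [NormedAddCommGroup H] [InnerProductSpace ℝ H]
  {X : H → Ω → ℝ} {P : Measure Ω}

lemma cylPair_congr (hX : IsIsonormal X P) {n m : ℕ} {φ : Fin n → H} {ψ : Fin m → H}
    {f : (Fin n → ℝ) → ℝ} {g : (Fin m → ℝ) → ℝ} (hf : IsTame f) (hg : IsTame g)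
    (h1 : ∀ ω, f (evalAt X φ ω) = g (evalAt X ψ ω))
    (h2 : ∀ ω, pullback φ (fderiv ℝ f (evalAt X φ ω)) = pullback ψ (fderiv ℝ g (evalAt X ψ ω))) :
    cylPair hX φ hf = cylPair hX ψ hg :=
  Prod.ext
    (MemLp.toLp_congr (memLp_cyl hX φ hf.continuous hf.growth)
      (memLp_cyl hX ψ hg.continuous hg.growth) (.of_forall h1))
    (MemLp.toLp_congr (memLp_grad hX φ hf) (memLp_grad hX ψ hg) (.of_forall h2))

/-- Forgetting coordinates along `j`. -/
def reindex {n m : ℕ} (j : Fin n → Fin m) : (Fin m → ℝ) →L[ℝ] (Fin n → ℝ) :=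
  ContinuousLinearMap.pi fun i => ContinuousLinearMap.proj (j i)

lemma reindex_evalAt {n m : ℕ} {j : Fin n → Fin m} {φ : Fin n → H} {θ : Fin m → H}
    (h : ∀ i, θ (j i) = φ i) (ω : Ω) : reindex j (evalAt X θ ω) = evalAt X φ ω := by
  ext i; simp [reindex, evalAt, h]

lemma pullback_comp_reindex {n m : ℕ} {j : Fin n → Fin m} {φ : Fin n → H} {θ : Fin m → H}
    (h : ∀ i, θ (j i) = φ i) (L : (Fin n → ℝ) →L[ℝ] ℝ) :
    pullback θ (L.comp (reindex j)) = pullback φ L := by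
  refine ext_inner_right ℝ fun v => ?_
  rw [inner_pullback, inner_pullback]
  simp only [ContinuousLinearMap.comp_apply]
  congr 1; ext i; simp [reindex, h]

lemma pullback_fderiv_reindex {n m : ℕ} {j : Fin n → Fin m} {φ : Fin n → H} {θ : Fin m → H}
    (h : ∀ i, θ (j i) = φ i) {f : (Fin n → ℝ) → ℝ} (hf : IsTame f) (ω : Ω) :
    pullback θ (fderiv ℝ (fun x => f (reindex j x)) (evalAt X θ ω)) =
      pullback φ (fderiv ℝ f (evalAt X φ ω)) := by
  have : fderiv ℝ (fun x => f (reindex j x)) (evalAt X θ ω) =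
      (fderiv ℝ f (reindex j (evalAt X θ ω))).comp (reindex j) :=
    ((hf.differentiable _).hasFDerivAt.comp _ (reindex j).hasFDerivAt).fderiv
  rw [this, pullback_comp_reindex h, reindex_evalAt h]

/-- Adding dummy coordinates changes neither the variable nor its derivative, so two cylindrical
variables can always be written on one common Gaussian vector. -/
lemma cylPair_reindex (hX : IsIsonormal X P) {n m : ℕ} {j : Fin n → Fin m} {φ : Fin n → H}
    {θ : Fin m → H} (h : ∀ i, θ (j i) = φ i) {f : (Fin n → ℝ) → ℝ} (hf : IsTame f) :
    cylPair hX θ (hf.comp_clm (reindex j)) = cylPair hX φ hf :=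
  cylPair_congr hX _ _ (fun ω => by rw [reindex_evalAt h])
    fun ω => pullback_fderiv_reindex h hf ω

lemma cylPair_add (hX : IsIsonormal X P) {n : ℕ} (φ : Fin n → H) {f g : (Fin n → ℝ) → ℝ}
    (hf : IsTame f) (hg : IsTame g) :
    cylPair hX φ (hf.add hg) = cylPair hX φ hf + cylPair hX φ hg := by
  refine Prod.ext (MemLp.toLp_add (memLp_cyl hX φ hf.continuous hf.growth)
    (memLp_cyl hX φ hg.continuous hg.growth)) ?_
  refine (MemLp.toLp_congr (memLp_grad hX φ (hf.add hg)) ((memLp_grad hX φ hf).add (memLp_grad hX φ hg))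
    (.of_forall fun ω => ?_)).trans (MemLp.toLp_add (memLp_grad hX φ hf) (memLp_grad hX φ hg))
  dsimp only [Pi.add_apply]
  rw [fderiv_fun_add (hf.differentiable _) (hg.differentiable _), map_add]

lemma cylPair_smul (hX : IsIsonormal X P) {n : ℕ} (φ : Fin n → H) {f : (Fin n → ℝ) → ℝ}
    (a : ℝ) (hf : IsTame f) :
    cylPair hX φ ((IsTame.const a).mul hf) = a • cylPair hX φ hf := by
  refine Prod.ext (MemLp.toLp_const_smul a (memLp_cyl hX φ hf.continuous hf.growth)) ?_
  refine (MemLp.toLp_congr (memLp_grad hX φ ((IsTame.const a).mul hf)) ((memLp_grad hX φ hf).const_smul a)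
    (.of_forall fun ω => ?_)).trans (MemLp.toLp_const_smul a (memLp_grad hX φ hf))
  dsimp only [Pi.smul_apply]
  rw [fderiv_const_mul (hf.differentiable _), map_smul]

/-- A linear combination is a single cylindrical variable on the concatenated vectors. Padding by
dummy coordinates destroys compact support, which is why only tameness is asserted. -/
lemma exists_cylPair_of_mem_span (hX : IsIsonormal X P) {p : Lp ℝ 2 P × Lp H 2 P}
    (hp : p ∈ Submodule.span ℝ {p : Lp ℝ 2 P × Lp H 2 P | IsSmoothCylinder X P p.1 p.2}) :
    ∃ (n : ℕ) (φ : Fin n → H) (f : (Fin n → ℝ) → ℝ) (hf : IsTame f), 1 ≤ n ∧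
      p = cylPair hX φ hf := by
  induction hp using Submodule.span_induction with
  | mem p hp =>
    obtain ⟨n, φ, f, hf, hn, -, h⟩ := IsSmoothCylinder.eq_cylPair hX hp
    exact ⟨n, φ, f, hf, hn, h⟩
  | zero =>
    exact ⟨1, fun _ => 0, _, (IsTame.const 0).mul (.const 0), le_rfl, by
      rw [cylPair_smul hX _ 0 (IsTame.const 0)]; simp⟩
  | add p q _ _ ihp ihq =>
    obtain ⟨n, φ, f, hf, hn, rfl⟩ := ihp
    obtain ⟨m, ψ, g, hg, hm, rfl⟩ := ihq
    refine ⟨n + m, Fin.append φ ψ, _, (hf.comp_clm (reindex (Fin.castAdd m))).add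
      (hg.comp_clm (reindex (Fin.natAdd n))), by omega, ?_⟩
    rw [cylPair_add hX _ (hf.comp_clm (reindex (Fin.castAdd m)))
      (hg.comp_clm (reindex (Fin.natAdd n))), cylPair_reindex hX (Fin.append_left φ ψ) hf,
      cylPair_reindex hX (Fin.append_right φ ψ) hg]
  | smul a p _ ih =>
    obtain ⟨n, φ, f, hf, hn, rfl⟩ := ih
    exact ⟨n, φ, _, (IsTame.const a).mul hf, hn, (cylPair_smul hX φ a hf).symm⟩

lemma derivGraph_le (hX : IsIsonormal X P) {S : Submodule ℝ (Lp ℝ 2 P × Lp H 2 P)}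
    (hS : IsClosed (S : Set (Lp ℝ 2 P × Lp H 2 P)))
    (h : ∀ (n : ℕ) (φ : Fin n → H) (f : (Fin n → ℝ) → ℝ) (hf : IsTame f), 1 ≤ n →
      HasCompactSupport f → cylPair hX φ hf ∈ S) : derivGraph X P ≤ S := by
  refine Submodule.topologicalClosure_minimal _ (Submodule.span_le.2 fun p hp => ?_) hS
  obtain ⟨n, φ, f, hf, hn, hs, hpe⟩ := IsSmoothCylinder.eq_cylPair hX hp
  have : p = cylPair hX φ hf := hpe
  rw [this]; exact h n φ f hf hn hs

/-- `gaussian_ibp` for `Y = X(h)`: by isonormality the covariance vector is `(⟨h, φᵢ⟩)ᵢ`, and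
`inner_pullback` recognises the gradient. -/
lemma cyl_ibp (hX : IsIsonormal X P) (h : H) {n : ℕ} (φ : Fin n → H) {f : (Fin n → ℝ) → ℝ}
    (hf : IsTame f) :
    ∫ ω, X h ω * f (evalAt X φ ω) ∂P =
      ∫ ω, inner ℝ (pullback φ (fderiv ℝ f (evalAt X φ ω))) h ∂P := by
  have hg := hasGaussianLaw_pair hX h φ
  rw [gaussian_ibp hg (hX.centered h) hf.contDiff_one hf.growth hf.growth_fderiv]
  congr 1; ext ω
  rw [inner_pullback]
  congr 1; ext i
  rw [eval_integral]
  · simp only [Pi.smul_apply, evalAt, smul_eq_mul]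
    exact hX.covariance h (φ i)
  · intro i
    have h1 : MemLp (X h) 2 P := hg.fst.memLp_two
    have h2 : MemLp (X (φ i)) 2 P := (hX.gaussian.hasGaussianLaw_eval _).memLp_two
    exact h1.integrable_mul h2

lemma integral_real_inner (f : Lp ℝ 2 P) {g : Ω → ℝ} (hg : MemLp g 2 P) :
    inner ℝ f (hg.toLp g) = ∫ ω, f ω * g ω ∂P := by
  rw [inner_toLp_right]; congr 1; ext ω; simp [mul_comm]

lemma memLp_cyl_smul (hX : IsIsonormal X P) (h : H) {n : ℕ} (φ : Fin n → H)
    {g : (Fin n → ℝ) → ℝ} (hg : IsTame g) : MemLp (fun ω => g (evalAt X φ ω) • h) 2 P :=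
  memLp_cyl hX φ (f := fun x => g x • h) (by have := hg.continuous; fun_prop)
    (hg.growth.smul (.const h))

/-- Integration by parts on the closed graph of the derivative. -/
lemma derivGraph_ibp (hX : IsIsonormal X P) {p : Lp ℝ 2 P × Lp H 2 P} (hp : p ∈ derivGraph X P)
    (h : H) {n : ℕ} (φ : Fin n → H) {g : (Fin n → ℝ) → ℝ} (hg : IsTame g) :
    inner ℝ p.2 ((memLp_cyl_smul hX h φ hg).toLp _) +
      inner ℝ p.1 (((memLp_grad hX φ hg).inner_const (𝕜 := ℝ) h).toLp _) =
      inner ℝ p.1 ((memLp_mul_cyl hX h φ hg.continuous hg.growth).toLp _) := by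
  set A := (memLp_cyl_smul hX h φ hg).toLp _
  set B := ((memLp_grad hX φ hg).inner_const (𝕜 := ℝ) h).toLp _
  set C := (memLp_mul_cyl hX h φ hg.continuous hg.growth).toLp _
  -- The identity says that a continuous linear functional of `p` vanishes, so it suffices to check
  -- it on the generators. There it is `cyl_ibp` for a product of two cylindrical variables,
  -- expanded by the Leibniz rule.
  let T : Lp ℝ 2 P × Lp H 2 P →L[ℝ] ℝ :=
    (innerSL ℝ A).comp (ContinuousLinearMap.snd ℝ _ _) +
      (innerSL ℝ (B - C)).comp (ContinuousLinearMap.fst ℝ _ _)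
  have hT : ∀ q, T q = inner ℝ q.2 A + inner ℝ q.1 B - inner ℝ q.1 C := fun q => by
    simp [T, real_inner_comm]; ring
  suffices h1 : derivGraph X P ≤ LinearMap.ker T.toLinearMap by
    have h2 : T p = 0 := h1 hp
    rw [hT] at h2; linarith
  refine derivGraph_le hX T.isClosed_ker fun m ψ f hf hm _ => ?_
  change T _ = 0
  rw [hT]
  have e1 := Fin.append_left ψ φ
  have e2 := Fin.append_right ψ φ
  set θ := Fin.append ψ φ with hθ
  have hf' := hf.comp_clm (reindex (Fin.castAdd n))
  have hg' := hg.comp_clm (reindex (Fin.natAdd m))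
  have key := cyl_ibp hX h θ (hf'.mul hg')
  have k1 : ∀ ω, f (reindex (Fin.castAdd n) (evalAt X θ ω)) = f (evalAt X ψ ω) := fun ω => by
    rw [reindex_evalAt e1]
  have k2 : ∀ ω, g (reindex (Fin.natAdd m) (evalAt X θ ω)) = g (evalAt X φ ω) := fun ω => by
    rw [reindex_evalAt e2]
  have k3 : ∀ ω, pullback θ (fderiv ℝ (fun x => f (reindex (Fin.castAdd n) x) *
      g (reindex (Fin.natAdd m) x)) (evalAt X θ ω)) =
      f (evalAt X ψ ω) • pullback φ (fderiv ℝ g (evalAt X φ ω)) +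
      g (evalAt X φ ω) • pullback ψ (fderiv ℝ f (evalAt X ψ ω)) := fun ω => by
    rw [fderiv_fun_mul (hf'.differentiable _) (hg'.differentiable _), map_add, map_smul, map_smul,
      pullback_fderiv_reindex e2 hg, pullback_fderiv_reindex e1 hf, k1, k2]
  simp only [k1, k2, k3, inner_add_left, real_inner_smul_left] at key
  rw [integral_add] at key
  · simp only [cylPair, A, B, C]
    rw [inner_toLp_toLp, inner_toLp_toLp, inner_toLp_toLp]
    have c1 : ∀ ω, inner ℝ (f (evalAt X ψ ω)) (inner ℝ (pullback φ (fderiv ℝ g (evalAt X φ ω))) h) =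
        f (evalAt X ψ ω) * inner ℝ (pullback φ (fderiv ℝ g (evalAt X φ ω))) h := fun ω => by
      simp [mul_comm]
    have c2 : ∀ ω, inner ℝ (f (evalAt X ψ ω)) (X h ω * g (evalAt X φ ω)) =
        X h ω * (f (evalAt X ψ ω) * g (evalAt X φ ω)) := fun ω => by simp; ring
    simp only [c1, c2, real_inner_smul_right]
    linarith
  · exact (memLp_cyl hX ψ hf.continuous hf.growth).integrable_mul
      ((memLp_grad hX φ hg).inner_const (𝕜 := ℝ) h)
  · exact (memLp_cyl hX φ hg.continuous hg.growth).integrable_mul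
      ((memLp_grad hX ψ hf).inner_const (𝕜 := ℝ) h)

/-- The closed span of the smooth cylindrical variables in `L²(Ω)`. -/
def cylClosure (X : H → Ω → ℝ) (P : Measure Ω) : Submodule ℝ (Lp ℝ 2 P) :=
  (Submodule.span ℝ {F | ∃ u, IsSmoothCylinder X P F u}).topologicalClosure

lemma fst_mem_cylClosure {p : Lp ℝ 2 P × Lp H 2 P} (hp : p ∈ derivGraph X P) :
    p.1 ∈ cylClosure X P := by
  have : derivGraph X P ≤ (cylClosure X P).comap (LinearMap.fst ℝ (Lp ℝ 2 P) (Lp H 2 P)) := by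
    refine Submodule.topologicalClosure_minimal _ (Submodule.span_le.2 fun q hq => ?_)
      ((Submodule.isClosed_topologicalClosure _).preimage continuous_fst)
    exact Submodule.le_topologicalClosure _ (Submodule.subset_span ⟨q.2, hq⟩)
  exact this hp

/-- `⟨u, h⟩` for `u ∈ L²(Ω; H)`. -/
lemma inner_compLp_mem_cylClosure (hX : IsIsonormal X P) {p : Lp ℝ 2 P × Lp H 2 P}
    (hp : p ∈ derivGraph X P) (h : H) :
    ContinuousLinearMap.compLpL 2 P (innerSL ℝ h) p.2 ∈ cylClosure X P := by
  let T : Lp ℝ 2 P × Lp H 2 P →L[ℝ] Lp ℝ 2 P :=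
    (ContinuousLinearMap.compLpL 2 P (innerSL ℝ h)).comp (ContinuousLinearMap.snd ℝ _ _)
  have : derivGraph X P ≤ (cylClosure X P).comap T.toLinearMap := by
    refine derivGraph_le hX
      ((Submodule.isClosed_topologicalClosure _).preimage T.continuous) fun n φ f hf hn hs => ?_
    refine Submodule.le_topologicalClosure _ (Submodule.subset_span ?_)
    -- For a generator, `⟨DF, h⟩` is a directional derivative of `f`, again smooth with compact
    -- support, hence again a smooth cylindrical variable.
    have hk : HasCompactSupport (fun x => fderiv ℝ f x (fun i => inner ℝ h (φ i))) :=
      hs.fderiv_apply ℝ _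
    have hkc : ContDiff ℝ ((⊤ : ℕ∞) : WithTop ℕ∞)
        (fun x => fderiv ℝ f x (fun i => inner ℝ h (φ i))) :=
      (hf.contDiff.fderiv_right (by simp)).clm_apply contDiff_const
    have ht := IsTame.of_hasCompactSupport hkc hk
    refine ⟨(cylPair hX φ ht).2, ?_⟩
    convert isSmoothCylinder_cylPair hX hn φ ht hk using 1
    refine Lp.ext ?_
    filter_upwards [ContinuousLinearMap.coeFn_compLpL (p := 2) (μ := P) (innerSL ℝ h)
      (cylPair hX φ hf).2, (memLp_grad hX φ hf).coeFn_toLp,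
      (memLp_cyl hX φ ht.continuous ht.growth).coeFn_toLp] with ω h1 h2 h3
    refine (h1.trans ?_).trans h3.symm
    simp only [cylPair]
    rw [h2]
    simp [real_inner_comm, ← inner_pullback]
  exact this hp

/-- With `F = 0`, integration by parts leaves `E[⟨u, h⟩ G] = 0` for every smooth cylindrical `G`. As
`⟨u, h⟩` lies in the closed span of such `G`, it vanishes; a countable dense set of `h` then gives
`u = 0` almost surely. -/
lemma eq_zero_of_mem_derivGraph [TopologicalSpace.SeparableSpace H] (hX : IsIsonormal X P)
    {u : Lp H 2 P} (hu : ((0 : Lp ℝ 2 P), u) ∈ derivGraph X P) : u = 0 := by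
  have h0 : ∀ h : H, ∀ᵐ ω ∂P, inner ℝ h (u ω) = 0 := by
    intro h
    have h1 : ContinuousLinearMap.compLpL 2 P (innerSL ℝ h) u = 0 := by
      refine eq_zero_of_mem_closure_span (inner_compLp_mem_cylClosure hX hu h) ?_
      rintro G ⟨v, hG⟩
      obtain ⟨n, φ, g, hg, -, -, hGv⟩ := IsSmoothCylinder.eq_cylPair hX hG
      have := derivGraph_ibp hX hu h φ hg
      simp only [inner_zero_left, add_zero] at this
      have hG1 : G = (cylPair hX φ hg).1 := congrArg Prod.fst hGv
      rw [hG1, real_inner_comm, ← this]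
      simp only [cylPair]
      rw [inner_toLp_right, inner_toLp_right]
      refine integral_congr_ae ?_
      filter_upwards [ContinuousLinearMap.coeFn_compLpL (p := 2) (μ := P) (innerSL ℝ h) u]
        with ω h2
      rw [h2, real_inner_smul_right]; simp [real_inner_comm]
    filter_upwards [ContinuousLinearMap.coeFn_compLpL (p := 2) (μ := P) (innerSL ℝ h) u,
      Lp.coeFn_zero ℝ 2 P] with ω h2 h3
    rw [h1, h3] at h2
    simpa using h2.symm
  have h1 : ∀ᵐ ω ∂P, ∀ k : ℕ, inner ℝ (TopologicalSpace.denseSeq H k) (u ω) = 0 :=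
    ae_all_iff.2 fun k => h0 _
  refine Lp.ext ?_
  filter_upwards [h1, Lp.coeFn_zero H 2 P] with ω h2 h3
  rw [h3]
  refine Dense.eq_zero_of_inner_right (𝕜 := ℝ) (TopologicalSpace.denseRange_denseSeq H) ?_
  rintro _ ⟨k, rfl⟩
  exact h2 k

/-- The Malliavin derivative is closable. -/
lemma derivGraph_unique [TopologicalSpace.SeparableSpace H] (hX : IsIsonormal X P)
    {F : Lp ℝ 2 P} {u v : Lp H 2 P} (hu : (F, u) ∈ derivGraph X P) (hv : (F, v) ∈ derivGraph X P) :
    u = v := by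
  have := (derivGraph X P).sub_mem hu hv
  simp only [Prod.mk_sub_mk, sub_self] at this
  exact sub_eq_zero.1 (eq_zero_of_mem_derivGraph hX this)

lemma deriv_eq [TopologicalSpace.SeparableSpace H] (hX : IsIsonormal X P)
    {F : Lp ℝ 2 P} {u : Lp H 2 P} (hu : (F, u) ∈ derivGraph X P) : deriv X P F = u := by
  have h : ∃ u, (F, u) ∈ derivGraph X P := ⟨u, hu⟩
  rw [deriv, dif_pos h]
  exact derivGraph_unique hX h.choose_spec hu

/-- The chain rule for the Malliavin derivative. -/
lemma derivGraph_comp (hX : IsIsonormal X P) {p : Lp ℝ 2 P × Lp H 2 P} (hp : p ∈ derivGraph X P)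
    {k : ℝ → ℝ} (hk : ContDiff ℝ ((⊤ : ℕ∞) : WithTop ℕ∞) k) {K : ℝ}
    (hK : ∀ x, |_root_.deriv k x| ≤ K) :
    ∃ q ∈ derivGraph X P, (q.1 =ᵐ[P] fun ω => k (p.1 ω)) ∧
      (q.2 =ᵐ[P] fun ω => _root_.deriv k (p.1 ω) • p.2 ω) := by
  have hPp := hX.gaussian.isProbabilityMeasure
  have hd : Differentiable ℝ k := hk.differentiable (by simp)
  have hdc : Continuous (_root_.deriv k) := hk.continuous_deriv (by simp)
  have hK0 : 0 ≤ K := (abs_nonneg _).trans (hK 0)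
  have hlip : ∀ x y, ‖k x - k y‖ ≤ K * ‖x - y‖ := fun x y =>
    Convex.norm_image_sub_le_of_norm_deriv_le (s := Set.univ)
      (fun x _ => hd x) (fun x _ => hK x) convex_univ (Set.mem_univ y) (Set.mem_univ x)
  obtain ⟨p₀, hp₀, hlim₀⟩ := mem_closure_iff_seq_limit.1 hp
  have hfst₀ : Tendsto (fun j => (p₀ j).1) atTop (𝓝 p.1) := (continuous_fst.tendsto p).comp hlim₀
  -- Almost sure convergence along a subsequence is needed to pass to the limit inside `k'`, which
  -- is only bounded and continuous.
  obtain ⟨ns, hns, hae⟩ := (tendstoInMeasure_of_tendsto_Lp hfst₀).exists_seq_tendsto_ae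
  choose n φ f hf hn heq using fun j => exists_cylPair_of_mem_span hX (hp₀ (ns j))
  have hlim : Tendsto (fun j => cylPair hX (φ j) (hf j)) atTop (𝓝 p) := by
    simp only [← heq]
    exact hlim₀.comp hns.tendsto_atTop
  have hfst : Tendsto (fun j => (cylPair hX (φ j) (hf j)).1) atTop (𝓝 p.1) :=
    (continuous_fst.tendsto p).comp hlim
  have hsnd : Tendsto (fun j => (cylPair hX (φ j) (hf j)).2) atTop (𝓝 p.2) :=
    (continuous_snd.tendsto p).comp hlim
  have hae' : ∀ᵐ ω ∂P, Tendsto (fun j => f j (evalAt X (φ j) ω)) atTop (𝓝 (p.1 ω)) := by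
    have h1 : ∀ᵐ ω ∂P, ∀ j, (p₀ (ns j)).1 ω = f j (evalAt X (φ j) ω) := by
      refine ae_all_iff.2 fun j => ?_
      filter_upwards [(memLp_cyl hX (φ j) (hf j).continuous (hf j).growth).coeFn_toLp] with ω h2
      rw [heq j]; exact h2
    filter_upwards [hae, h1] with ω h2 h3
    simpa only [h3] using h2
  have m1 : MemLp (fun ω => k (p.1 ω)) 2 P := by
    have h1 : MemLp (fun ω => K * ‖p.1 ω‖ + ‖k 0‖) 2 P :=
      ((Lp.memLp p.1).norm.const_mul K).add (memLp_const _)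
    refine h1.mono (hk.continuous.comp_aestronglyMeasurable (Lp.aestronglyMeasurable p.1))
      (.of_forall fun ω => ?_)
    have h2 := hlip (p.1 ω) 0
    have h3 := norm_sub_norm_le (k (p.1 ω)) (k 0)
    rw [sub_zero] at h2
    rw [Real.norm_of_nonneg (r := K * ‖p.1 ω‖ + ‖k 0‖) (by positivity)]
    linarith
  have mk : ∀ {c : Ω → ℝ}, AEStronglyMeasurable c P → (∀ ω, |c ω| ≤ K) →
      MemLp (fun ω => c ω • p.2 ω) 2 P := fun {c} hc hb => by
    refine ((Lp.memLp p.2).norm.const_mul K).mono (hc.smul (Lp.aestronglyMeasurable p.2))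
      (.of_forall fun ω => ?_)
    rw [norm_smul, Real.norm_eq_abs, Real.norm_of_nonneg (by positivity)]
    gcongr; exact hb ω
  have m2 : MemLp (fun ω => _root_.deriv k (p.1 ω) • p.2 ω) 2 P :=
    mk (hdc.comp_aestronglyMeasurable (Lp.aestronglyMeasurable p.1)) fun ω => hK _
  have m3 : ∀ j, MemLp (fun ω => _root_.deriv k (f j (evalAt X (φ j) ω)) • p.2 ω) 2 P := fun j =>
    mk ((hdc.comp (hf j).continuous).comp_aestronglyMeasurable
      (measurable_evalAt hX _).aestronglyMeasurable) fun ω => hK _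
  refine ⟨(m1.toLp _, m2.toLp _), ?_, m1.coeFn_toLp, m2.coeFn_toLp⟩
  refine isClosed_derivGraph.mem_of_tendsto (b := atTop)
    (f := fun j => cylPair hX (φ j) ((hf j).comp hk hK)) ?_
    (.of_forall fun j => cylPair_mem_derivGraph hX (hn j) _ _)
  refine Tendsto.prodMk_nhds ?_ ?_
  · rw [tendsto_iff_norm_sub_tendsto_zero] at hfst ⊢
    refine squeeze_zero (fun _ => norm_nonneg _) (fun j => ?_) (by simpa using hfst.const_mul K)
    change ‖(cylPair hX (φ j) ((hf j).comp hk hK)).1 - m1.toLp _‖ ≤ _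
    refine Lp.norm_le_mul_norm_of_ae_le_mul ?_
    filter_upwards [Lp.coeFn_sub (cylPair hX (φ j) ((hf j).comp hk hK)).1 (m1.toLp _),
      Lp.coeFn_sub (cylPair hX (φ j) (hf j)).1 p.1, m1.coeFn_toLp,
      (memLp_cyl hX (φ j) (hf j).continuous (hf j).growth).coeFn_toLp,
      (memLp_cyl hX (φ j) ((hf j).comp hk hK).continuous ((hf j).comp hk hK).growth).coeFn_toLp]
      with ω h1 h2 h3 h4 h5
    rw [h1, h2, Pi.sub_apply, Pi.sub_apply, h3]
    simp only [cylPair]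
    rw [h4, h5]
    exact hlip _ _
  -- The mixed term `k'(Fⱼ) DF` is inserted: it tends to `k'(F) DF` by domination, and differs from
  -- `k'(Fⱼ) DFⱼ` by at most `K ‖DFⱼ - DF‖` in norm.
  · have hb : Tendsto (fun j => (m3 j).toLp _) atTop (𝓝 (m2.toLp _)) := by
      refine tendsto_toLp_of_dominated (b := fun ω => K * ‖p.2 ω‖) _ _
        ((Lp.memLp p.2).norm.const_mul K) (fun j => .of_forall fun ω => ?_) ?_
      · rw [norm_smul, Real.norm_eq_abs]; gcongr; exact hK _
      · filter_upwards [hae'] with ω h1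
        exact ((hdc.tendsto _).comp h1).smul_const _
    have hdiff : Tendsto (fun j => (cylPair hX (φ j) ((hf j).comp hk hK)).2 - (m3 j).toLp _)
        atTop (𝓝 0) := by
      rw [tendsto_iff_norm_sub_tendsto_zero] at hsnd
      refine squeeze_zero_norm (fun j => ?_) (by simpa using hsnd.const_mul K)
      refine Lp.norm_le_mul_norm_of_ae_le_mul ?_
      filter_upwards [Lp.coeFn_sub (cylPair hX (φ j) ((hf j).comp hk hK)).2 ((m3 j).toLp _),
        Lp.coeFn_sub (cylPair hX (φ j) (hf j)).2 p.2, (m3 j).coeFn_toLp,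
        (memLp_grad hX (φ j) (hf j)).coeFn_toLp,
        (memLp_grad hX (φ j) ((hf j).comp hk hK)).coeFn_toLp]
        with ω h1 h2 h3 h4 h5
      rw [h1, h2, Pi.sub_apply, Pi.sub_apply, h3]
      simp only [cylPair]
      rw [h4, h5, (hf j).fderiv_comp hk, map_smul, ← smul_sub, norm_smul, Real.norm_eq_abs]
      gcongr; exact hK _
    have h := hdiff.add hb
    simp only [sub_add_cancel, zero_add] at h
    exact h

end Graph

/-! ### Algebra of Hermite polynomials -/

section HermitePolynomials

open Polynomial

lemma derivative_hermite_succ (m : ℕ) :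
    derivative (hermite (m + 1)) = ((m : ℤ[X]) + 1) * hermite m := by
  induction m with
  | zero => simp [hermite_succ]
  | succ m ih =>
    have h1 : X * hermite m - derivative (hermite m) = hermite (m + 1) := (hermite_succ m).symm
    rw [hermite_succ (m + 1), derivative_sub, derivative_mul, derivative_X, ih, derivative_mul]
    simp only [derivative_add, derivative_natCast, derivative_one]
    push_cast
    linear_combination ((m : ℤ[X]) + 1) * h1

/-- The real Hermite polynomials span all polynomials. -/
lemma mem_of_hermite_mem {N : Submodule ℝ ℝ[X]}
    (h : ∀ m, (hermite m).map (Int.castRingHom ℝ) ∈ N) (p : ℝ[X]) : p ∈ N := by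
  -- Multiplication by `X` preserves the span, since `X Hₘ = Hₘ₊₁ + Hₘ'` and `Hₘ'` is a multiple of
  -- `Hₘ₋₁`. Keeping every `m` in the statement lets the induction on `k` run.
  have key : ∀ k m : ℕ, X ^ k * (hermite m).map (Int.castRingHom ℝ) ∈ N := by
    intro k
    induction k with
    | zero => simpa using h
    | succ k ih =>
      intro m
      have h0 : X * hermite m = hermite (m + 1) + derivative (hermite m) := by
        rw [hermite_succ]; ring
      have h1 : X * (hermite m).map (Int.castRingHom ℝ) =
          (hermite (m + 1)).map (Int.castRingHom ℝ) +
            (derivative (hermite m)).map (Int.castRingHom ℝ) := by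
        rw [← Polynomial.map_add, ← h0]; simp
      rw [pow_succ, mul_assoc, h1, mul_add]
      refine N.add_mem (ih _) ?_
      cases m with
      | zero => simp
      | succ m =>
        rw [derivative_hermite_succ]
        have := N.smul_mem ((m : ℝ) + 1) (ih m)
        convert this using 1
        simp [Polynomial.smul_eq_C_mul]; ring
  induction p using Polynomial.induction_on with
  | C a =>
    have := N.smul_mem a (key 0 0)
    simpa [Polynomial.smul_eq_C_mul] using this
  | add p q hp hq => exact N.add_mem hp hq
  | monomial n a _ =>
    have := N.smul_mem a (key (n + 1) 0)
    simpa [Polynomial.smul_eq_C_mul] using this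

end HermitePolynomials

/-! ### Wiener chaoses as eigenspaces of the Ornstein-Uhlenbeck generator -/

section Chaos

variable {Ω H : Type*} [MeasurableSpace Ω] [NormedAddCommGroup H] [InnerProductSpace ℝ H]
  {X : H → Ω → ℝ} {P : Measure Ω}

lemma isTame_polynomial_coord (p : Polynomial ℝ) : IsTame (fun x : Fin 1 → ℝ => p.eval (x 0)) :=
  (IsTame.polynomial p).comp_clm (ContinuousLinearMap.proj (R := ℝ) (φ := fun _ : Fin 1 => ℝ) 0)

lemma isTame_hermite (m : ℕ) :
    IsTame (fun x : Fin 1 → ℝ => Polynomial.aeval (x 0) (Polynomial.hermite m)) := by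
  simpa [Polynomial.aeval_def, Polynomial.eval₂_eq_eval_map] using
    isTame_polynomial_coord ((Polynomial.hermite m).map (Int.castRingHom ℝ))

lemma pullback_fderiv_hermite (h : H) (m : ℕ) (x : Fin 1 → ℝ) :
    pullback (fun _ : Fin 1 => h) (fderiv ℝ
      (fun x : Fin 1 → ℝ => Polynomial.aeval (x 0) (Polynomial.hermite m)) x) =
      (Polynomial.aeval (x 0) (Polynomial.derivative (Polynomial.hermite m)) : ℝ) • h := by
  have h1 : HasFDerivAt (fun x : Fin 1 → ℝ => Polynomial.aeval (x 0) (Polynomial.hermite m))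
      ((Polynomial.aeval (x 0) (Polynomial.derivative (Polynomial.hermite m)) : ℝ) •
        ContinuousLinearMap.proj (R := ℝ) (φ := fun _ : Fin 1 => ℝ) 0) x :=
    HasDerivAt.comp_hasFDerivAt (h₂ := fun y : ℝ => Polynomial.aeval y (Polynomial.hermite m)) x
      (Polynomial.hasDerivAt_aeval _ _)
      (ContinuousLinearMap.proj (R := ℝ) (φ := fun _ : Fin 1 => ℝ) 0).hasFDerivAt
  rw [h1.fderiv, pullback_apply]
  simp

/-- `Hₘ(X(h))` together with its derivative `Hₘ'(X(h)) h`. -/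
def hermitePair (hX : IsIsonormal X P) (h : H) (m : ℕ) : Lp ℝ 2 P × Lp H 2 P :=
  cylPair hX (fun _ : Fin 1 => h) (isTame_hermite m)

lemma hermitePair_fst (hX : IsIsonormal X P) (h : H) (m : ℕ) : (hermitePair hX h m).1 =ᵐ[P]
    fun ω => Polynomial.aeval (X h ω) (Polynomial.hermite m) :=
  (memLp_cyl hX (fun _ : Fin 1 => h) (isTame_hermite m).continuous
    (isTame_hermite m).growth).coeFn_toLp

lemma hermitePair_snd (hX : IsIsonormal X P) (h : H) (m : ℕ) : (hermitePair hX h m).2 =ᵐ[P]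
    fun ω => (Polynomial.aeval (X h ω) (Polynomial.derivative (Polynomial.hermite m)) : ℝ) • h := by
  filter_upwards [(memLp_grad hX (fun _ : Fin 1 => h) (isTame_hermite m)).coeFn_toLp] with ω h1
  refine h1.trans ?_
  rw [pullback_fderiv_hermite]; rfl

lemma hermitePair_mem (hX : IsIsonormal X P) (h : H) (m : ℕ) :
    hermitePair hX h m ∈ derivGraph X P := cylPair_mem_derivGraph hX le_rfl _ _

/-- In positive degree `D Hₘ₊₁(X(h)) = (m+1) Hₘ(X(h)) h`, and integrating by parts against it
produces `X(h) Hₘ(X(h)) - ‖h‖² Hₘ'(X(h))`. For `‖h‖ = 1` this is `Hₘ₊₁(X(h))` by the recursion. -/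
lemma hermitePair_eigen (hX : IsIsonormal X P) {h : H} {m : ℕ} (hm : m = 0 ∨ ‖h‖ = 1)
    {q : Lp ℝ 2 P × Lp H 2 P} (hq : q ∈ derivGraph X P) :
    inner ℝ q.2 (hermitePair hX h m).2 = m * inner ℝ q.1 (hermitePair hX h m).1 := by
  cases m with
  | zero =>
    have : (hermitePair hX h 0).2 = 0 := by
      refine Lp.ext ?_
      filter_upwards [hermitePair_snd hX h 0, Lp.coeFn_zero H 2 P] with ω h1 h2
      rw [h1, h2]; simp
    simp [this]
  | succ m =>
    have hn : ‖h‖ = 1 := by simpa using hm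
    have key := derivGraph_ibp hX hq h (fun _ : Fin 1 => h) (isTame_hermite m)
    have e1 : (hermitePair hX h (m + 1)).2 = ((m + 1 : ℕ) : ℝ) •
        (memLp_cyl_smul hX h (fun _ : Fin 1 => h) (isTame_hermite m)).toLp _ := by
      refine Lp.ext ?_
      filter_upwards [hermitePair_snd hX h (m + 1), Lp.coeFn_smul ((m + 1 : ℕ) : ℝ)
        ((memLp_cyl_smul hX h (fun _ : Fin 1 => h) (isTame_hermite m)).toLp _),
        (memLp_cyl_smul hX h (fun _ : Fin 1 => h) (isTame_hermite m)).coeFn_toLp] with ω h1 h2 h3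
      rw [h1, h2, Pi.smul_apply, h3, smul_smul, derivative_hermite_succ]
      simp [evalAt]
    have e2 : (hermitePair hX h (m + 1)).1 =
        (memLp_mul_cyl hX h (fun _ : Fin 1 => h) (isTame_hermite m).continuous
          (isTame_hermite m).growth).toLp _ -
        ((memLp_grad hX (fun _ : Fin 1 => h) (isTame_hermite m)).inner_const (𝕜 := ℝ) h).toLp _ := by
      rw [← MemLp.toLp_sub]
      refine Lp.ext ?_
      filter_upwards [hermitePair_fst hX h (m + 1), MemLp.coeFn_toLp
        ((memLp_mul_cyl hX h (fun _ : Fin 1 => h) (isTame_hermite m).continuous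
          (isTame_hermite m).growth).sub
        ((memLp_grad hX (fun _ : Fin 1 => h) (isTame_hermite m)).inner_const (𝕜 := ℝ) h))]
        with ω h1 h2
      rw [h1, h2, Pi.sub_apply, pullback_fderiv_hermite, real_inner_smul_left,
        real_inner_self_eq_norm_sq, hn, Polynomial.hermite_succ]
      simp [evalAt]
    rw [e1, e2, inner_sub_right, inner_smul_right, ← key]
    ring

/-- The pairs `(G, DG)` with `E⟨u, DG⟩ = m E[F G]` for all `(F, u)` in the graph of `D`, that is,
the eigenvectors of the Ornstein-Uhlenbeck generator of eigenvalue `-m` with their derivatives. -/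
def eigenGraph (X : H → Ω → ℝ) (P : Measure Ω) (m : ℕ) : Submodule ℝ (Lp ℝ 2 P × Lp H 2 P) where
  carrier := {p | p ∈ derivGraph X P ∧
    ∀ q ∈ derivGraph X P, inner ℝ q.2 p.2 = m * inner ℝ q.1 p.1}
  add_mem' := fun {a b} ha hb => ⟨Submodule.add_mem _ ha.1 hb.1, fun q hq => by
    simp only [Prod.snd_add, Prod.fst_add, inner_add_right, ha.2 q hq, hb.2 q hq]; ring⟩
  zero_mem' := ⟨Submodule.zero_mem _, fun q _ => by simp⟩
  smul_mem' := fun c a ha => ⟨Submodule.smul_mem _ c ha.1, fun q hq => by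
    simp only [Prod.smul_snd, Prod.smul_fst, inner_smul_right, ha.2 q hq]; ring⟩

lemma isClosed_eigenGraph (m : ℕ) :
    IsClosed (eigenGraph X P m : Set (Lp ℝ 2 P × Lp H 2 P)) := by
  have : (eigenGraph X P m : Set (Lp ℝ 2 P × Lp H 2 P)) = (derivGraph X P : Set _) ∩
      ⋂ q ∈ derivGraph X P, {p | inner ℝ q.2 p.2 = m * inner ℝ q.1 p.1} := by
    ext p; simp [eigenGraph]
  rw [this]
  refine isClosed_derivGraph.inter (isClosed_biInter fun q _ => isClosed_eq ?_ ?_)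
  · fun_prop
  · fun_prop

/-- The eigenvector relation tested against the pair itself; it controls the derivative by the
variable. -/
lemma eigenGraph_norm {m : ℕ} {p : Lp ℝ 2 P × Lp H 2 P} (hp : p ∈ eigenGraph X P m) :
    ‖p.2‖ ^ 2 = m * ‖p.1‖ ^ 2 := by
  have := hp.2 p hp.1
  rwa [real_inner_self_eq_norm_sq, real_inner_self_eq_norm_sq] at this

/-- The span is covered by `hermitePair_eigen`. For the closure, `eigenGraph_norm` makes `F ↦ DF` an
isometry up to the factor `√m`, so the derivatives of an approximating sequence are Cauchy and
converge within the closed `eigenGraph`. -/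
lemma exists_mem_eigenGraph [CompleteSpace H] (hX : IsIsonormal X P) {m : ℕ} {G : Lp ℝ 2 P}
    (hG : G ∈ wienerChaos X P m) : ∃ v, (G, v) ∈ eigenGraph X P m := by
  have h1 : ∀ F ∈ Submodule.span ℝ {F : Lp ℝ 2 P | ∃ h : H, (m = 0 ∨ ‖h‖ = 1) ∧
      F =ᵐ[P] fun ω => Polynomial.aeval (X h ω) (Polynomial.hermite m)},
      ∃ v, (F, v) ∈ eigenGraph X P m := by
    intro F hF
    have h2 : F ∈ (eigenGraph X P m).map (LinearMap.fst ℝ (Lp ℝ 2 P) (Lp H 2 P)) := by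
      refine Submodule.span_le.2 ?_ hF
      rintro F ⟨h, hm, hF⟩
      have h3 : F = (hermitePair hX h m).1 := Lp.ext (hF.trans (hermitePair_fst hX h m).symm)
      exact ⟨hermitePair hX h m,
        ⟨hermitePair_mem hX h m, fun q hq => hermitePair_eigen hX hm hq⟩, h3.symm⟩
    obtain ⟨⟨F', v⟩, hv, rfl⟩ := h2
    exact ⟨v, hv⟩
  obtain ⟨F, hF, hlim⟩ := mem_closure_iff_seq_limit.1 hG
  choose v hv using fun k => h1 (F k) (hF k)
  have hdist : ∀ k l, dist (v k) (v l) = √m * dist (F k) (F l) := by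
    intro k l
    have h4 := eigenGraph_norm (Submodule.sub_mem _ (hv k) (hv l))
    simp only [Prod.mk_sub_mk] at h4
    rw [dist_eq_norm, dist_eq_norm, ← Real.sqrt_sq (norm_nonneg (v k - v l)), h4,
      Real.sqrt_mul (Nat.cast_nonneg m), Real.sqrt_sq (norm_nonneg _)]
  have hc : CauchySeq v := by
    rw [cauchySeq_iff_tendsto_dist_atTop_0]
    have h5 := (cauchySeq_iff_tendsto_dist_atTop_0.1 hlim.cauchySeq).const_mul (√m)
    simpa only [hdist, mul_zero] using h5
  obtain ⟨w, hw⟩ := cauchySeq_tendsto_of_complete hc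
  exact ⟨w, (isClosed_eigenGraph m).mem_of_tendsto (hlim.prodMk_nhds hw) (.of_forall hv)⟩

/-- The form `E⟨DF, DG⟩` is symmetric, so eigenvectors with distinct eigenvalues are orthogonal, and
then so are their derivatives. -/
lemma eigenGraph_orthogonal {m k : ℕ} (hmk : m ≠ k) {p q : Lp ℝ 2 P × Lp H 2 P}
    (hp : p ∈ eigenGraph X P m) (hq : q ∈ eigenGraph X P k) :
    inner ℝ p.1 q.1 = 0 ∧ inner ℝ p.2 q.2 = 0 := by
  have h1 := hp.2 q hq.1
  have h2 := hq.2 p hp.1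
  rw [real_inner_comm, h2, real_inner_comm q.1 p.1] at h1
  have h3 : ((k : ℝ) - m) * inner ℝ q.1 p.1 = 0 := by linarith [real_inner_comm q.1 p.1]
  have h4 : ((k : ℝ) - m) ≠ 0 := sub_ne_zero.2 (by exact_mod_cast hmk.symm)
  have h5 : inner ℝ p.1 q.1 = 0 := by
    rw [real_inner_comm]; exact (mul_eq_zero.1 h3).resolve_left h4
  exact ⟨h5, by rw [h2, h5, mul_zero]⟩

lemma wienerChaos_orthogonal [CompleteSpace H] (hX : IsIsonormal X P) {m k : ℕ} (hmk : m ≠ k) {F G : Lp ℝ 2 P}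
    (hF : F ∈ wienerChaos X P m) (hG : G ∈ wienerChaos X P k) : inner ℝ F G = 0 := by
  obtain ⟨u, hu⟩ := exists_mem_eigenGraph hX hF
  obtain ⟨v, hv⟩ := exists_mem_eigenGraph hX hG
  exact (eigenGraph_orthogonal hmk hu hv).1

end Chaos

/-! ### From vanishing moments to vanishing expectations -/

section CharFun

variable {Ω : Type*} [MeasurableSpace Ω] {P : Measure Ω}

/-- The exponential series is integrated term by term, dominated by `|G| exp(|r||Y|)`, and each term
is a multiple of a vanishing moment. -/
lemma integral_mul_exp_eq_zero_of_moments {G Y : Ω → ℝ} (hYm : AEStronglyMeasurable Y P)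
    (hG : AEStronglyMeasurable G P) (r : ℝ)
    (hi : Integrable (fun ω => |G ω| * Real.exp (|r| * |Y ω|)) P)
    (h : ∀ k : ℕ, ∫ ω, G ω * Y ω ^ k ∂P = 0) :
    ∫ ω, (G ω : ℂ) * Complex.exp ((r * Y ω : ℝ) * Complex.I) ∂P = 0 := by
  have hreal : ∀ ω, HasSum (fun k : ℕ => |G ω| * ((|r| * |Y ω|) ^ k / k.factorial))
      (|G ω| * Real.exp (|r| * |Y ω|)) := fun ω => by
    have := (NormedSpace.expSeries_div_hasSum_exp (|r| * |Y ω|)).mul_left |G ω|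
    rwa [← Real.exp_eq_exp_ℝ] at this
  have key := hasSum_integral_of_dominated_convergence (μ := P)
    (F := fun (k : ℕ) ω => (G ω : ℂ) * (((r * Y ω : ℝ) * Complex.I) ^ k / k.factorial))
    (f := fun ω => (G ω : ℂ) * Complex.exp ((r * Y ω : ℝ) * Complex.I))
    (fun k ω => |G ω| * ((|r| * |Y ω|) ^ k / k.factorial)) (fun k => ?_)
    (fun k => .of_forall fun ω => ?_) (.of_forall fun ω => (hreal ω).summable) ?_
    (.of_forall fun ω => ?_)
  · have hz : ∀ k : ℕ, ∫ ω, (G ω : ℂ) * (((r * Y ω : ℝ) * Complex.I) ^ k / k.factorial) ∂P = 0 := by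
      intro k
      have e : ∀ ω, (G ω : ℂ) * (((r * Y ω : ℝ) * Complex.I) ^ k / k.factorial) =
          ((r : ℂ) * Complex.I) ^ k / k.factorial * ((G ω * Y ω ^ k : ℝ) : ℂ) := fun ω => by
        push_cast; ring
      simp only [e]
      rw [integral_const_mul, integral_complex_ofReal, h k]; simp
    simp only [hz] at key
    exact key.unique hasSum_zero
  · have h1 : AEStronglyMeasurable (fun ω => (G ω : ℂ)) P :=
      Complex.continuous_ofReal.comp_aestronglyMeasurable hG
    have h2 : AEStronglyMeasurable
        (fun ω => (((r * Y ω : ℝ) : ℂ) * Complex.I) ^ k / k.factorial) P :=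
      (by fun_prop : Continuous fun y : ℝ =>
        (((r * y : ℝ) : ℂ) * Complex.I) ^ k / k.factorial).comp_aestronglyMeasurable hYm
    exact h1.mul h2
  · simp
  · exact hi.congr (.of_forall fun ω => (hreal ω).tsum_eq.symm)
  · have := (NormedSpace.expSeries_div_hasSum_exp (((r * Y ω : ℝ) : ℂ) * Complex.I)).mul_left
      (G ω : ℂ)
    rwa [← Complex.exp_eq_exp_ℂ] at this

/-- The images under `V` of the finite measures `G⁺ P` and `G⁻ P` have the same characteristic
function, hence coincide. -/
lemma integral_mul_comp_eq_zero_of_charFun {E : Type*} [NormedAddCommGroup E] [NormedSpace ℝ E]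
    [CompleteSpace E] [SecondCountableTopology E] [MeasurableSpace E] [BorelSpace E]
    {G : Ω → ℝ} (hG : Integrable G P) {V : Ω → E} (hV : Measurable V)
    (h : ∀ L : StrongDual ℝ E, ∫ ω, (G ω : ℂ) * Complex.exp (L (V ω) * Complex.I) ∂P = 0)
    {f : E → ℝ} (hf : Continuous f) {C : ℝ} (hC : ∀ x, ‖f x‖ ≤ C) :
    ∫ ω, G ω * f (V ω) ∂P = 0 := by
  have hGm := hG.aestronglyMeasurable.aemeasurable
  have hGn : AEMeasurable (fun ω => -G ω) P := hGm.neg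
  let ρ : Measure Ω := P.withDensity fun ω => ENNReal.ofReal (G ω)
  let ν : Measure Ω := P.withDensity fun ω => ENNReal.ofReal (-G ω)
  have : IsFiniteMeasure ρ := isFiniteMeasure_withDensity_ofReal hG.2
  have : IsFiniteMeasure ν := isFiniteMeasure_withDensity_ofReal hG.neg.2
  have split : ∀ {F : Type} [NormedAddCommGroup F] [NormedSpace ℝ F] (k : Ω → F),
      AEStronglyMeasurable k P → (∃ D, ∀ ω, ‖k ω‖ ≤ D) →
      ∫ ω, G ω • k ω ∂P = ∫ ω, k ω ∂ρ - ∫ ω, k ω ∂ν := by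
    rintro F _ _ k hk ⟨D, hD⟩
    rw [integral_withDensity_eq_integral_toReal_smul₀ hGm.ennreal_ofReal (by simp),
      integral_withDensity_eq_integral_toReal_smul₀ hGn.ennreal_ofReal (by simp),
      ← integral_sub]
    · congr 1; ext ω
      rw [← sub_smul, ENNReal.toReal_ofReal', ENNReal.toReal_ofReal']
      congr 1
      rcases le_total 0 (G ω) with h0 | h0
      · rw [max_eq_left h0, max_eq_right (by linarith)]; ring
      · rw [max_eq_right h0, max_eq_left (by linarith)]; ring
    · refine Integrable.smul_bdd ?_ D hk (.of_forall hD)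
      exact hG.abs.mono' hGm.ennreal_ofReal.ennreal_toReal.aestronglyMeasurable
        (.of_forall fun ω => by
          rw [ENNReal.toReal_ofReal', Real.norm_of_nonneg (le_max_right _ _)]
          exact max_le (le_abs_self _) (abs_nonneg _))
    · refine Integrable.smul_bdd ?_ D hk (.of_forall hD)
      exact hG.abs.mono' hGn.ennreal_ofReal.ennreal_toReal.aestronglyMeasurable
        (.of_forall fun ω => by
          rw [ENNReal.toReal_ofReal', Real.norm_of_nonneg (le_max_right _ _)]
          exact max_le (neg_le_abs _) (abs_nonneg _))
  have heq : ρ.map V = ν.map V := by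
    refine Measure.ext_of_charFunDual (funext fun L => ?_)
    rw [charFunDual_apply, charFunDual_apply, integral_map hV.aemeasurable (by fun_prop),
      integral_map hV.aemeasurable (by fun_prop), ← sub_eq_zero,
      ← split (fun ω => Complex.exp (L (V ω) * Complex.I)) ?_ ⟨1, fun ω => ?_⟩]
    · simpa using h L
    · exact ((by fun_prop : Continuous fun x => Complex.exp (L x * Complex.I)).measurable.comp
        hV).aestronglyMeasurable
    · rw [Complex.norm_exp_ofReal_mul_I]
  have h1 := split (fun ω => f (V ω)) (hf.measurable.comp hV).aestronglyMeasurable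
    ⟨C, fun ω => hC _⟩
  rw [← integral_map (φ := V) hV.aemeasurable hf.aestronglyMeasurable,
    ← integral_map (φ := V) hV.aemeasurable hf.aestronglyMeasurable, heq, sub_self] at h1
  simpa using h1

end CharFun

/-! ### Totality of the chaoses among cylindrical variables -/

section Completeness

variable {Ω H : Type*} [MeasurableSpace Ω] [NormedAddCommGroup H] [InnerProductSpace ℝ H]
  {X : H → Ω → ℝ} {P : Measure Ω}

lemma memLp_isonormal (hX : IsIsonormal X P) (h : H) : MemLp (X h) 2 P :=
  (hX.gaussian.hasGaussianLaw_eval h).memLp_two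

/-- An isonormal process is linear in its argument, almost surely. -/
lemma isonormal_sum (hX : IsIsonormal X P) {n : ℕ} (t : Fin n → ℝ) (φ : Fin n → H) {e : H} {r : ℝ}
    (h : ∑ i, t i • φ i = r • e) : ∀ᵐ ω ∂P, ∑ i, t i * X (φ i) ω = r * X e ω := by
  let Φ : H → Lp ℝ 2 P := fun h => (memLp_isonormal hX h).toLp _
  have hΦ : ∀ h k, inner ℝ (Φ h) (Φ k) = inner ℝ h k := fun h k => by
    simp only [Φ]
    rw [inner_toLp_toLp, ← hX.covariance h k]
    congr 1; ext ω; simp [mul_comm]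
  -- `Φ` preserves inner products, so the squared norm of this combination equals that of `∑ tᵢ φᵢ -
  -- r e`, which is zero.
  have h0 : ∑ i, t i • Φ (φ i) - r • Φ e = 0 := by
    have h1 : inner ℝ (∑ i, t i • Φ (φ i) - r • Φ e) (∑ i, t i • Φ (φ i) - r • Φ e) =
        inner ℝ (∑ i, t i • φ i - r • e) (∑ i, t i • φ i - r • e) := by
      simp only [inner_sub_left, inner_sub_right, sum_inner, inner_sum, real_inner_smul_left,
        real_inner_smul_right, hΦ]
    rw [h, sub_self, inner_zero_left] at h1
    exact inner_self_eq_zero.1 h1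
  have h1 : MemLp (fun ω => ∑ i, t i * X (φ i) ω - r * X e ω) 2 P :=
    (memLp_finsetSum _ fun i _ => (memLp_isonormal hX (φ i)).const_mul (t i)).sub
      ((memLp_isonormal hX e).const_mul r)
  have h2 : ∫ ω, (∑ i, t i * X (φ i) ω - r * X e ω) ^ 2 ∂P = 0 := by
    have h3 := congrArg (fun F : Lp ℝ 2 P => (F : Ω → ℝ)) h0
    have h4 : (fun ω => ∑ i, t i * X (φ i) ω - r * X e ω) =ᵐ[P] (0 : Ω → ℝ) := by
      have h5 : h1.toLp _ = ∑ i, t i • Φ (φ i) - r • Φ e := by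
        refine Lp.ext ?_
        have h6 : ∀ᵐ ω ∂P, ∀ i, Φ (φ i) ω = X (φ i) ω :=
          ae_all_iff.2 fun i => (memLp_isonormal hX (φ i)).coeFn_toLp
        have h7 : ∀ᵐ ω ∂P, ∀ i, (t i • Φ (φ i) : Lp ℝ 2 P) ω = t i • Φ (φ i) ω :=
          ae_all_iff.2 fun i => Lp.coeFn_smul _ _
        filter_upwards [h1.coeFn_toLp, Lp.coeFn_sub (∑ i, t i • Φ (φ i)) (r • Φ e),
          Lp.coeFn_fun_finsetSum Finset.univ (fun i => t i • Φ (φ i)), Lp.coeFn_smul r (Φ e), h6,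
          h7, (memLp_isonormal hX e).coeFn_toLp] with ω a1 a2 a3 a4 a5 a6 a7
        rw [a1, a2, Pi.sub_apply, a3, a4, Pi.smul_apply]
        simp only [a6, a5, Φ, smul_eq_mul]
        rw [a7]
      rw [h0] at h5
      exact h1.coeFn_toLp.symm.trans (by rw [h5]; exact Lp.coeFn_zero ℝ 2 P)
    refine integral_eq_zero_of_ae ?_
    filter_upwards [h4] with ω h5
    rw [h5]; simp
  have h3 := (integral_eq_zero_iff_of_nonneg (fun ω => sq_nonneg _) h1.integrable_sq).1 h2
  filter_upwards [h3] with ω h4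
  exact sub_eq_zero.1 (pow_eq_zero_iff two_ne_zero |>.1 h4)

lemma hermitePair_fst_mem (hX : IsIsonormal X P) {h : H} {m : ℕ} (hm : m = 0 ∨ ‖h‖ = 1) :
    (hermitePair hX h m).1 ∈ wienerChaos X P m :=
  Submodule.le_topologicalClosure _ (Submodule.subset_span ⟨h, hm, hermitePair_fst hX h m⟩)

lemma integral_mul_pow_eq_zero (hX : IsIsonormal X P) {G : Lp ℝ 2 P} {e : H}
    (h : ∀ m, inner ℝ G (hermitePair hX e m).1 = 0) (k : ℕ) :
    ∫ ω, G ω * X e ω ^ k ∂P = 0 := by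
  have hp : ∀ p : Polynomial ℝ, MemLp (fun ω => p.eval (X e ω)) 2 P := fun p =>
    memLp_cyl hX (fun _ : Fin 1 => e) (isTame_polynomial_coord p).continuous
      (isTame_polynomial_coord p).growth
  have hi : ∀ p : Polynomial ℝ, Integrable (fun ω => G ω * p.eval (X e ω)) P := fun p =>
    (Lp.memLp G).integrable_mul (hp p)
  let N : Submodule ℝ (Polynomial ℝ) :=
    { carrier := {p | ∫ ω, G ω * p.eval (X e ω) ∂P = 0}
      add_mem' := fun {p q} h1 h2 => by
        simp only [Set.mem_ofPred_eq, Polynomial.eval_add, mul_add] at h1 h2 ⊢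
        rw [integral_add (hi p) (hi q), h1, h2, add_zero]
      zero_mem' := by simp
      smul_mem' := fun c p h1 => by
        simp only [Set.mem_ofPred_eq, Polynomial.eval_smul, smul_eq_mul] at h1 ⊢
        simp only [mul_left_comm _ c]
        rw [integral_const_mul, h1, mul_zero] }
  have h1 : Polynomial.X ^ k ∈ N := by
    refine mem_of_hermite_mem (fun m => ?_) _
    have h2 := h m
    rw [L2.inner_def] at h2
    change ∫ ω, _ ∂P = 0
    rw [← h2]
    refine integral_congr_ae ?_
    filter_upwards [hermitePair_fst hX e m] with ω h3
    rw [h3, ← Polynomial.eval₂_eq_eval_map, Polynomial.aeval_def]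
    simp [mul_comm]
  simpa [N] using h1

/-- The Wiener chaoses span the closure of the smooth cylindrical variables. -/
lemma eq_zero_of_orthogonal_chaos (hX : IsIsonormal X P) {G : Lp ℝ 2 P}
    (hG : G ∈ cylClosure X P) (h : ∀ m, ∀ F ∈ wienerChaos X P m, inner ℝ G F = 0) : G = 0 := by
  have hPp := hX.gaussian.isProbabilityMeasure
  have hGi : Integrable G P := (Lp.memLp G).integrable one_le_two
  refine eq_zero_of_mem_closure_span hG ?_
  rintro F ⟨u, hF⟩
  obtain ⟨n, φ, f, hf, hn, hs, hp⟩ := IsSmoothCylinder.eq_cylPair hX hF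
  have hF1 : F = (cylPair hX φ hf).1 := congrArg Prod.fst hp
  rw [hF1, real_inner_comm]
  simp only [cylPair]
  rw [integral_real_inner]
  obtain ⟨C, hC⟩ := hf.continuous.bounded_above_of_compact_support hs
  refine integral_mul_comp_eq_zero_of_charFun hGi (measurable_evalAt hX φ) (fun L => ?_)
    hf.continuous hC
  have hL : ∀ x : Fin n → ℝ, L x = ∑ i, L (Pi.single i 1) * x i := fun x => by
    conv_lhs => rw [← Finset.univ_sum_single x, map_sum]
    refine Finset.sum_congr rfl fun i _ => ?_
    have : (Pi.single i (x i) : Fin n → ℝ) = x i • Pi.single i 1 := by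
      rw [← Pi.single_smul]; simp
    rw [this, map_smul, smul_eq_mul, mul_comm]
  -- A linear form of the Gaussian vector is almost surely `X(k)`. If `k = 0` the exponential is `1`
  -- and orthogonality to constants suffices; otherwise `k` is normalised, as positive-degree
  -- chaoses are generated by unit vectors.
  set k : H := ∑ i, L (Pi.single i 1) • φ i with hk
  by_cases hk0 : k = 0
  · have h1 := isonormal_sum hX (fun i => L (Pi.single i 1)) φ (e := 0) (r := 0)
      (by rw [← hk, hk0]; simp)
    have h2 : ∫ ω, G ω ∂P = 0 := by
      have h3 := h 0 _ (hermitePair_fst_mem hX (h := 0) (Or.inl rfl))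
      rw [L2.inner_def] at h3
      rw [← h3]
      refine integral_congr_ae ?_
      filter_upwards [hermitePair_fst hX 0 0] with ω h4
      rw [h4]; simp
    have h5 : ∫ ω, (G ω : ℂ) ∂P = 0 := by rw [integral_complex_ofReal, h2]; simp
    rw [← h5]
    refine integral_congr_ae ?_
    filter_upwards [h1] with ω h6
    rw [hL]
    simp only [evalAt]
    rw [h6]; simp
  · set e := ‖k‖⁻¹ • k with he
    have hk1 : ‖k‖ ≠ 0 := norm_ne_zero_iff.2 hk0
    have he1 : ‖e‖ = 1 := by rw [he, norm_smul, norm_inv, norm_norm, inv_mul_cancel₀ hk1]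
    have h1 := isonormal_sum hX (fun i => L (Pi.single i 1)) φ (e := e) (r := ‖k‖)
      (by rw [← hk, he, smul_smul, mul_inv_cancel₀ hk1, one_smul])
    have h2 := integral_mul_pow_eq_zero hX
      (fun m => h m _ (hermitePair_fst_mem hX (Or.inr he1)))
    have hYg := hX.gaussian.hasGaussianLaw_eval e
    have hexp : ExpGrowth (fun x : ℝ => Real.exp (|(‖k‖)| * |x|)) :=
      ⟨1, |(‖k‖)|, zero_le_one, abs_nonneg _, fun x => by simp⟩
    have h3 := integral_mul_exp_eq_zero_of_moments (hX.measurable e).aestronglyMeasurable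
      (Lp.aestronglyMeasurable G) ‖k‖ ((Lp.memLp G).abs.integrable_mul
        (hexp.memLp_two hYg ((by fun_prop : Continuous fun x : ℝ =>
          Real.exp (|(‖k‖)| * |x|)).comp_aestronglyMeasurable
            (hX.measurable e).aestronglyMeasurable))) h2
    rw [← h3]
    refine integral_congr_ae ?_
    filter_upwards [h1] with ω h6
    rw [hL]
    simp only [evalAt]
    rw [h6]

end Completeness

/-! ### Orthogonal series in Hilbert space -/

section Hilbert

variable {A : Type*} [NormedAddCommGroup A] [InnerProductSpace ℝ A]

/-- Bessel's inequality: expanding `‖Z - ∑ Jᵢ‖² ≥ 0` bounds every finite sum of `‖Jᵢ‖²` by `‖Z‖²`.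
-/
lemma summable_sq_norm_of_orthogonal {J : ℕ → A} {Z : A}
    (ho : ∀ i j, i ≠ j → inner ℝ (J i) (J j) = 0) (hZ : ∀ i, inner ℝ Z (J i) = ‖J i‖ ^ 2) :
    Summable fun i => ‖J i‖ ^ 2 := by
  refine summable_of_sum_le (c := ‖Z‖ ^ 2) (fun i => sq_nonneg _) fun s => ?_
  have h1 : ‖∑ i ∈ s, J i‖ ^ 2 = ∑ i ∈ s, ‖J i‖ ^ 2 := by
    rw [← real_inner_self_eq_norm_sq, sum_inner]
    refine Finset.sum_congr rfl fun i hi => ?_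
    rw [inner_sum, Finset.sum_eq_single i (fun j _ hj => ho i j hj.symm)
      (fun h => absurd hi h), real_inner_self_eq_norm_sq]
  have h2 : inner ℝ Z (∑ i ∈ s, J i) = ∑ i ∈ s, ‖J i‖ ^ 2 := by
    rw [inner_sum]; exact Finset.sum_congr rfl fun i _ => hZ i
  have h3 := norm_sub_sq_real Z (∑ i ∈ s, J i)
  rw [h1, h2] at h3
  nlinarith [sq_nonneg ‖Z - ∑ i ∈ s, J i‖]

lemma summable_of_orthogonal [CompleteSpace A] {J : ℕ → A}
    (ho : ∀ i j, i ≠ j → inner ℝ (J i) (J j) = 0) (hs : Summable fun i => ‖J i‖ ^ 2) :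
    Summable J := by
  have hV : OrthogonalFamily ℝ (fun i => (Submodule.span ℝ {J i}))
      fun i => (Submodule.span ℝ {J i}).subtypeₗᵢ := by
    refine OrthogonalFamily.of_pairwise fun i j hij => ?_
    change Submodule.span ℝ {J i} ⟂ Submodule.span ℝ {J j}
    rw [Submodule.isOrtho_span]
    rintro _ rfl _ rfl
    exact ho i j hij
  exact (hV.summable_iff_norm_sq_summable
    fun i => ⟨J i, Submodule.mem_span_singleton_self (J i)⟩).2 hs

end Hilbert

/-! ### The inverse generator and the integration by parts formula for Z -/

section OrnsteinUhlenbeck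

variable {Ω H : Type*} [MeasurableSpace Ω] [NormedAddCommGroup H] [InnerProductSpace ℝ H]
  {X : H → Ω → ℝ} {P : Measure Ω}

lemma chaosProj_mem (m : ℕ) (Z : Lp ℝ 2 P) : chaosProj X P m Z ∈ wienerChaos X P m :=
  Submodule.starProjection_apply_mem _ _

lemma inner_chaosProj {m : ℕ} {F : Lp ℝ 2 P} (hF : F ∈ wienerChaos X P m) (Z : Lp ℝ 2 P) :
    inner ℝ (chaosProj X P m Z) F = inner ℝ Z F := by
  rw [chaosProj, Submodule.inner_starProjection_left_eq_right,
    Submodule.starProjection_eq_self_iff.2 hF]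

lemma inner_chaosProj_self (m : ℕ) (Z : Lp ℝ 2 P) :
    inner ℝ Z (chaosProj X P m Z) = ‖chaosProj X P m Z‖ ^ 2 := by
  rw [← inner_chaosProj (chaosProj_mem m Z), real_inner_self_eq_norm_sq]

variable [CompleteSpace H]

lemma chaosProj_orthogonal (hX : IsIsonormal X P) (Z : Lp ℝ 2 P) {i j : ℕ} (h : i ≠ j) :
    inner ℝ (chaosProj X P i Z) (chaosProj X P j Z) = 0 :=
  wienerChaos_orthogonal hX h (chaosProj_mem i Z) (chaosProj_mem j Z)

lemma summable_chaosProj (hX : IsIsonormal X P) (Z : Lp ℝ 2 P) :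
    Summable fun m => chaosProj X P (m + 1) Z :=
  summable_of_orthogonal (fun i j h => chaosProj_orthogonal hX Z (by omega))
    (summable_sq_norm_of_orthogonal (Z := Z) (fun i j h => chaosProj_orthogonal hX Z (by omega))
      fun i => inner_chaosProj_self _ Z)

/-- The Wiener chaos decomposition of a centered variable in the closed span of the smooth
cylindrical variables. -/
lemma tsum_chaosProj (hX : IsIsonormal X P) {Z : Lp ℝ 2 P} (hZ : Z ∈ cylClosure X P)
    (hZ0 : ∫ ω, Z ω ∂P = 0) : ∑' m, chaosProj X P (m + 1) Z = Z := by
  have hs := (summable_chaosProj hX Z).hasSum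
  set S := ∑' m, chaosProj X P (m + 1) Z with hS
  have hmem : ∀ m, chaosProj X P m Z ∈ cylClosure X P := fun m => by
    obtain ⟨v, hv⟩ := exists_mem_eigenGraph hX (chaosProj_mem (X := X) m Z)
    exact fst_mem_cylClosure hv.1
  have hSm : S ∈ cylClosure X P :=
    (Submodule.isClosed_topologicalClosure _).mem_of_tendsto hs
      (.of_forall fun s => Submodule.sum_mem _ fun m _ => hmem _)
  have hinner : ∀ F : Lp ℝ 2 P, HasSum (fun m => inner ℝ (chaosProj X P (m + 1) Z) F)
      (inner ℝ S F) := fun F => by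
    have := hs.mapL (innerSL ℝ F)
    simpa [real_inner_comm] using this
  refine (sub_eq_zero.1 ?_).symm
  -- Totality reduces the claim to equality of the projections of `Z` and `S` on each chaos. The
  -- series starts at degree one, so in degree zero this is the centering of `Z`.
  refine eq_zero_of_orthogonal_chaos hX (Submodule.sub_mem _ hZ hSm) fun k F hF => ?_
  rw [inner_sub_left, sub_eq_zero]
  cases k with
  | zero =>
    have h1 : inner ℝ Z F = 0 := by
      have h2 : wienerChaos X P 0 ≤ LinearMap.ker (innerSL ℝ Z).toLinearMap := by
        refine Submodule.topologicalClosure_minimal _ (Submodule.span_le.2 ?_)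
          (innerSL ℝ Z).isClosed_ker
        rintro G ⟨h, -, hG⟩
        change inner ℝ Z G = 0
        rw [L2.inner_def, ← hZ0]
        refine integral_congr_ae ?_
        filter_upwards [hG] with ω h3
        rw [h3]; simp
      exact h2 hF
    have h3 : ∀ m, inner ℝ (chaosProj X P (m + 1) Z) F = 0 := fun m =>
      wienerChaos_orthogonal hX (by omega) (chaosProj_mem _ Z) hF
    have h4 := hinner F
    simp only [h3] at h4
    rw [h1, h4.unique hasSum_zero]
  | succ k =>
    have h3 : ∀ m, m ≠ k → inner ℝ (chaosProj X P (m + 1) Z) F = 0 := fun m hm =>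
      wienerChaos_orthogonal hX (by omega) (chaosProj_mem _ Z) hF
    rw [(hinner F).unique (hasSum_single k h3), inner_chaosProj hF]

/-- `L⁻¹ Z` is in the domain of `D`, and `-D L⁻¹ Z` represents `F ↦ E[F Z]` on derivatives. -/
lemma exists_deriv_ouInv (hX : IsIsonormal X P) {Z : Lp ℝ 2 P} (hZ : Z ∈ cylClosure X P)
    (hZ0 : ∫ ω, Z ω ∂P = 0) : ∃ w, (ouInv X P Z, w) ∈ derivGraph X P ∧
      ∀ q ∈ derivGraph X P, inner ℝ q.2 (-w) = inner ℝ q.1 Z := by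
  choose v hv using fun m => exists_mem_eigenGraph hX (chaosProj_mem (X := X) (m + 1) Z)
  let c : ℕ → ℝ := fun m => 1 / ((m : ℝ) + 1)
  have hc0 : ∀ m, 0 ≤ c m := fun m => by positivity
  have hc1 : ∀ m, c m * (m + 1) = 1 := fun m => by simp only [c]; field_simp
  have hc2 : ∀ m, c m ≤ 1 := fun m => by
    simp only [c]; rw [div_le_one (by positivity)]; linarith [(Nat.cast_nonneg m : (0:ℝ) ≤ m)]
  have hsq : Summable fun m => ‖chaosProj X P (m + 1) Z‖ ^ 2 :=
    summable_sq_norm_of_orthogonal (Z := Z) (fun i j h => chaosProj_orthogonal hX Z (by omega))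
      fun i => inner_chaosProj_self _ Z
  have hsJ : Summable fun m => (-c m) • chaosProj X P (m + 1) Z := by
    refine summable_of_orthogonal (fun i j h => ?_) ?_
    · rw [real_inner_smul_left, real_inner_smul_right, chaosProj_orthogonal hX Z (by omega)]; simp
    · refine hsq.of_nonneg_of_le (fun m => sq_nonneg _) fun m => ?_
      rw [norm_smul, norm_neg, Real.norm_of_nonneg (hc0 m)]
      gcongr
      exact mul_le_of_le_one_left (norm_nonneg _) (hc2 m)
  have hsv : Summable fun m => (-c m) • v m := by
    refine summable_of_orthogonal (fun i j h => ?_) ?_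
    · have := (eigenGraph_orthogonal (by omega) (hv i) (hv j)).2
      simp only at this
      rw [real_inner_smul_left, real_inner_smul_right, this]; simp
    · refine hsq.of_nonneg_of_le (fun m => sq_nonneg _) fun m => ?_
      have h1 := eigenGraph_norm (hv m)
      simp only at h1
      rw [norm_smul, norm_neg, Real.norm_of_nonneg (hc0 m), mul_pow, h1]
      push_cast
      -- The factor `m + 1` in the squared norm of the derivative is absorbed by one of the two
      -- weights `1 / (m + 1)`; hence the series of derivatives converges for every `Z` in L².
      have h2 : c m ^ 2 * ((m + 1) * ‖chaosProj X P (m + 1) Z‖ ^ 2) =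
          c m * ‖chaosProj X P (m + 1) Z‖ ^ 2 := by
        linear_combination c m * ‖chaosProj X P (m + 1) Z‖ ^ 2 * hc1 m
      rw [h2]
      exact mul_le_of_le_one_left (sq_nonneg _) (hc2 m)
  refine ⟨∑' m, (-c m) • v m, ?_, fun q hq => ?_⟩
  · have h1 : HasSum (fun m => (-c m) • (chaosProj X P (m + 1) Z, v m))
        (ouInv X P Z, ∑' m, (-c m) • v m) := hsJ.hasSum.prodMk hsv.hasSum
    exact isClosed_derivGraph.mem_of_tendsto h1
      (.of_forall fun s => Submodule.sum_mem _ fun m _ => Submodule.smul_mem _ _ (hv m).1)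
  · have h1 := hsv.hasSum.mapL (innerSL ℝ q.2)
    have h2 := (summable_chaosProj hX Z).hasSum.mapL (innerSL ℝ q.1)
    rw [tsum_chaosProj hX hZ hZ0] at h2
    -- Here the weight of `L⁻¹` cancels the eigenvalue exactly, leaving the chaos expansion of `Z`
    -- with the opposite sign.
    have h3 : ∀ m, innerSL ℝ q.2 ((-c m) • v m) =
        -(innerSL ℝ q.1 (chaosProj X P (m + 1) Z)) := fun m => by
      have h4 := (hv m).2 q hq
      simp only at h4
      simp only [innerSL_apply_apply, inner_smul_right, h4]
      push_cast
      linear_combination -(inner ℝ q.1 (chaosProj X P (m + 1) Z)) * hc1 m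
    simp only [h3] at h1
    have h5 := h1.unique h2.neg
    simp only [innerSL_apply_apply] at h5
    rw [inner_neg_right, h5, neg_neg]

variable [TopologicalSpace.SeparableSpace H]

lemma integrable_steinPairing (F : Lp ℝ 2 P) : Integrable (steinPairing X P F) P :=
  L2.integrable_inner (𝕜 := ℝ) _ _

/-- The integration by parts formula `E[k(Z) Z] = E[k'(Z) ⟨DZ, -D L⁻¹ Z⟩]`. -/
lemma integral_comp_mul (hX : IsIsonormal X P) {Z : Lp ℝ 2 P} (hZ : Z ∈ D12 X P)
    (hZ0 : ∫ ω, Z ω ∂P = 0) {k : ℝ → ℝ} (hk : ContDiff ℝ ((⊤ : ℕ∞) : WithTop ℕ∞) k) {K : ℝ}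
    (hK : ∀ x, |_root_.deriv k x| ≤ K) :
    ∫ ω, k (Z ω) * Z ω ∂P = ∫ ω, _root_.deriv k (Z ω) * steinPairing X P Z ω ∂P := by
  obtain ⟨⟨Z', u⟩, hu, rfl⟩ := hZ
  simp only [LinearMap.fst_apply] at hZ0 ⊢
  obtain ⟨w, hw, hw2⟩ := exists_deriv_ouInv hX (fst_mem_cylClosure hu) hZ0
  obtain ⟨q, hq, hq1, hq2⟩ := derivGraph_comp hX hu hk hK
  have h1 := hw2 q hq
  rw [L2.inner_def, L2.inner_def] at h1
  simp only at h1 hq1 hq2 hw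
  calc ∫ ω, k (Z' ω) * Z' ω ∂P = ∫ ω, inner ℝ (q.1 ω) (Z' ω) ∂P := by
        refine integral_congr_ae ?_
        filter_upwards [hq1] with ω h2
        rw [h2]; simp [mul_comm]
    _ = _ := by
        rw [← h1]
        refine integral_congr_ae ?_
        filter_upwards [hq2] with ω h2
        rw [h2, real_inner_smul_left, steinPairing, deriv_eq hX hu, deriv_eq hX hw]

end OrnsteinUhlenbeck

/-! ### From a Stein-type inequality to a Gaussian-type tail -/

section TailBound

/-- Gronwall: `m(θ) exp(-bθ²/2)` is nonincreasing. Derivatives are only required in the open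
interval, since for the truncated Laplace transform domination is available only for `0 ≤ θ ≤ T`. -/
lemma le_mul_exp_of_deriv_le {m m' : ℝ → ℝ} {b T : ℝ} (hT : 0 ≤ T)
    (hc : ContinuousOn m (Set.Icc 0 T)) (hd : ∀ θ ∈ Set.Ioo 0 T, HasDerivAt m (m' θ) θ)
    (hle : ∀ θ ∈ Set.Ioo 0 T, m' θ ≤ b * θ * m θ) : m T ≤ m 0 * Real.exp (b * T ^ 2 / 2) := by
  let e : ℝ → ℝ := fun θ => Real.exp (-(b * θ ^ 2 / 2))
  have he : ∀ θ, HasDerivAt e (e θ * -(b * θ)) θ := fun θ => by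
    have h := ((((hasDerivAt_id θ).pow 2).const_mul b).div_const 2).neg.exp
    convert! h using 1
    simp only [e, id, Pi.pow_apply, Pi.neg_apply]
    ring_nf
  have hd' : ∀ θ ∈ Set.Ioo 0 T,
      HasDerivAt (fun θ => m θ * e θ) (m' θ * e θ + m θ * (e θ * -(b * θ))) θ := fun θ hθ =>
    (hd θ hθ).mul (he θ)
  have hanti : AntitoneOn (fun θ => m θ * e θ) (Set.Icc 0 T) := by
    refine antitoneOn_of_deriv_nonpos (convex_Icc 0 T) (hc.mul ?_) ?_ ?_
    · exact fun θ _ => (he θ).continuousAt.continuousWithinAt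
    · rw [interior_Icc]
      exact fun θ hθ => (hd' θ hθ).differentiableAt.differentiableWithinAt
    · rw [interior_Icc]
      intro θ hθ
      rw [(hd' θ hθ).deriv]
      have h1 : 0 < e θ := Real.exp_pos _
      have h2 := mul_le_mul_of_nonneg_right (hle θ hθ) h1.le
      linarith
  have h := hanti (Set.left_mem_Icc.2 hT) (Set.right_mem_Icc.2 hT) hT
  simp only [e, Real.exp_neg] at h
  rw [← div_eq_mul_inv, div_le_iff₀ (Real.exp_pos _)] at h
  simpa using h

/-- A smooth nonincreasing cutoff, equal to `1` before `A` and to `0` after `A + 1`. -/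
def cutoff (A z : ℝ) : ℝ := Real.smoothTransition (A + 1 - z)

lemma contDiff_cutoff (A : ℝ) : ContDiff ℝ ((⊤ : ℕ∞) : WithTop ℕ∞) (cutoff A) :=
  (Real.smoothTransition.contDiff (n := ⊤)).comp (contDiff_const.sub contDiff_id)

lemma cutoff_nonneg (A z : ℝ) : 0 ≤ cutoff A z := Real.smoothTransition.nonneg _

lemma cutoff_le_one (A z : ℝ) : cutoff A z ≤ 1 := Real.smoothTransition.le_one _

lemma cutoff_antitone (A : ℝ) : Antitone (cutoff A) := fun x y h =>
  Real.smoothTransition.monotone (by linarith)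

lemma cutoff_eq_one {A z : ℝ} (h : z ≤ A) : cutoff A z = 1 :=
  Real.smoothTransition.one_of_one_le (by linarith)

lemma cutoff_eq_zero {A z : ℝ} (h : A + 1 ≤ z) : cutoff A z = 0 :=
  Real.smoothTransition.zero_of_nonpos (by linarith)

lemma exp_mul_cutoff_nonneg (A θ z : ℝ) : 0 ≤ Real.exp (θ * z) * cutoff A z :=
  mul_nonneg (Real.exp_pos _).le (cutoff_nonneg A z)

lemma exp_mul_cutoff_le {A θ T : ℝ} (hA : 0 ≤ A) (hθ : 0 ≤ θ) (hT : θ ≤ T) (z : ℝ) :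
    Real.exp (θ * z) * cutoff A z ≤ Real.exp (T * (A + 1)) := by
  rcases le_total (A + 1) z with h | h
  · rw [cutoff_eq_zero h, mul_zero]; exact (Real.exp_pos _).le
  · refine (mul_le_of_le_one_right (Real.exp_pos _).le (cutoff_le_one A z)).trans (Real.exp_le_exp.2 ?_)
    exact (mul_le_mul_of_nonneg_left h hθ).trans (mul_le_mul_of_nonneg_right hT (by linarith))

/-- A primitive of `z ↦ θ e^{θ z} ψ(z)`, where `ψ` is the cutoff. -/
def cutoffExp (A θ z : ℝ) : ℝ :=
  cutoff A 0 + ∫ y in (0 : ℝ)..z, θ * (Real.exp (θ * y) * cutoff A y)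

lemma hasDerivAt_cutoffExp (A θ z : ℝ) :
    HasDerivAt (cutoffExp A θ) (θ * (Real.exp (θ * z) * cutoff A z)) z := by
  have hc : Continuous fun y => θ * (Real.exp (θ * y) * cutoff A y) := by
    have := (contDiff_cutoff A).continuous; fun_prop
  exact (intervalIntegral.integral_hasDerivAt_right (hc.intervalIntegrable _ _)
    (hc.stronglyMeasurableAtFilter _ _) hc.continuousAt).const_add _

lemma contDiff_cutoffExp (A θ : ℝ) : ContDiff ℝ ((⊤ : ℕ∞) : WithTop ℕ∞) (cutoffExp A θ) := by
  refine contDiff_infty_iff_deriv.2 ⟨fun z => (hasDerivAt_cutoffExp A θ z).differentiableAt, ?_⟩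
  have : _root_.deriv (cutoffExp A θ) = fun z => θ * (Real.exp (θ * z) * cutoff A z) :=
    funext fun z => (hasDerivAt_cutoffExp A θ z).deriv
  rw [this]
  exact contDiff_const.mul ((contDiff_const.mul contDiff_id).exp.mul (contDiff_cutoff A))

/-- The difference of `cutoffExp` and `e^{θz} ψ(z)` has derivative `-e^{θz} ψ'(z) ≥ 0`, because the
cutoff decreases. The additive constant in `cutoffExp` makes it vanish at `0`, so it has the sign of
`z`. -/
lemma mul_exp_cutoff_le (A θ z : ℝ) :
    z * (Real.exp (θ * z) * cutoff A z) ≤ cutoffExp A θ z * z := by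
  let D : ℝ → ℝ := fun z => cutoffExp A θ z - Real.exp (θ * z) * cutoff A z
  have hψ : ∀ z, HasDerivAt (cutoff A) (_root_.deriv (cutoff A) z) z := fun z =>
    ((contDiff_cutoff A).differentiable (by simp) z).hasDerivAt
  have hD : ∀ z, HasDerivAt D (-(Real.exp (θ * z) * _root_.deriv (cutoff A) z)) z := fun z => by
    have h1 : HasDerivAt (fun z => Real.exp (θ * z)) (Real.exp (θ * z) * θ) z := by
      simpa using ((hasDerivAt_id z).const_mul θ).exp
    convert! (hasDerivAt_cutoffExp A θ z).sub (h1.mul (hψ z)) using 1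
    ring
  have hmono : Monotone D := by
    refine monotone_of_deriv_nonneg (fun z => (hD z).differentiableAt) fun z => ?_
    rw [(hD z).deriv, neg_nonneg]
    exact mul_nonpos_of_nonneg_of_nonpos (Real.exp_pos _).le ((cutoff_antitone A).deriv_nonpos)
  have hD0 : D 0 = 0 := by simp [D, cutoffExp]
  have h : 0 ≤ D z * z := by
    rcases le_total 0 z with h | h
    · exact mul_nonneg (hD0 ▸ hmono h) h
    · exact mul_nonneg_of_nonpos_of_nonpos (hD0 ▸ hmono h) h
  simp only [D] at h
  linarith

variable {Ω : Type*} [MeasurableSpace Ω] {P : Measure Ω} [IsProbabilityMeasure P]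

lemma memLp_comp_of_bounded_deriv {Z : Ω → ℝ} (hZ2 : MemLp Z 2 P) {k : ℝ → ℝ}
    (hk : ContDiff ℝ ((⊤ : ℕ∞) : WithTop ℕ∞) k) {K : ℝ} (hK : ∀ x, |_root_.deriv k x| ≤ K) :
    MemLp (fun ω => k (Z ω)) 2 P := by
  have hK0 : 0 ≤ K := (abs_nonneg _).trans (hK 0)
  have h1 : MemLp (fun ω => K * ‖Z ω‖ + ‖k 0‖) 2 P :=
    (hZ2.norm.const_mul K).add (memLp_const _)
  refine h1.mono (hk.continuous.comp_aestronglyMeasurable hZ2.1) (.of_forall fun ω => ?_)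
  have h2 : ‖k (Z ω) - k 0‖ ≤ K * ‖Z ω - 0‖ :=
    Convex.norm_image_sub_le_of_norm_deriv_le (s := Set.univ)
      (fun x _ => hk.differentiable (by simp) x) (fun x _ => hK x) convex_univ
      (Set.mem_univ 0) (Set.mem_univ (Z ω))
  have h3 := norm_sub_norm_le (k (Z ω)) (k 0)
  rw [sub_zero] at h2
  rw [Real.norm_of_nonneg (r := K * ‖Z ω‖ + ‖k 0‖) (by positivity)]
  linarith

/-- The concentration bound for a variable whose Stein factor is at most `α Z + β`. -/
lemma tail_bound {Z : Ω → ℝ} (hZm : Measurable Z) (hZ2 : MemLp Z 2 P) {α β : ℝ} (hα : 0 ≤ α)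
    (hβ : 0 < β)
    (h : ∀ k : ℝ → ℝ, ContDiff ℝ ((⊤ : ℕ∞) : WithTop ℕ∞) k → (∀ x, 0 ≤ _root_.deriv k x) →
      (∃ K, ∀ x, _root_.deriv k x ≤ K) →
      ∫ ω, k (Z ω) * Z ω ∂P ≤ ∫ ω, _root_.deriv k (Z ω) * (α * Z ω + β) ∂P)
    {z : ℝ} (hz : 0 < z) :
    P.real {ω | z ≤ Z ω} ≤ Real.exp (-(z ^ 2 / (2 * α * z + 2 * β))) := by
  have hZi : Integrable Z P := hZ2.integrable one_le_two
  have hd0 : 0 < α * z + β := by positivity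
  -- This `T` minimises `-Tz + (αz + β) T² / 2`. Below, `c` is the value of `1 - αθ` at `θ = T`, its
  -- minimum on `[0, T]`, and `b = β / c = αz + β`.
  set T := z / (α * z + β) with hT
  have hT0 : 0 < T := by positivity
  set c := β / (α * z + β) with hc
  have hc0 : 0 < c := by positivity
  have hcT : 1 - α * T = c := by rw [hT, hc]; field_simp; ring
  set b := β / c with hb
  have key : ∀ A : ℝ, 0 ≤ A →
      ∫ ω, Real.exp (T * Z ω) * cutoff A (Z ω) ∂P ≤ Real.exp (b * T ^ 2 / 2) := by
    intro A hA
    have hψc := (contDiff_cutoff A).continuous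
    let m : ℝ → ℝ := fun θ => ∫ ω, Real.exp (θ * Z ω) * cutoff A (Z ω) ∂P
    let m' : ℝ → ℝ := fun θ => ∫ ω, Z ω * (Real.exp (θ * Z ω) * cutoff A (Z ω)) ∂P
    have hmeas : ∀ θ, Measurable fun ω => Real.exp (θ * Z ω) * cutoff A (Z ω) := fun θ =>
      (by fun_prop : Continuous fun x => Real.exp (θ * x) * cutoff A x).measurable.comp hZm
    have hbd : ∀ θ, 0 ≤ θ → θ ≤ T → ∀ ω, ‖Real.exp (θ * Z ω) * cutoff A (Z ω)‖ ≤
        Real.exp (T * (A + 1)) := fun θ h0 h1 ω => by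
      rw [Real.norm_of_nonneg (exp_mul_cutoff_nonneg A θ _)]
      exact exp_mul_cutoff_le hA h0 h1 _
    have hint : ∀ θ, 0 ≤ θ → θ ≤ T →
        Integrable (fun ω => Real.exp (θ * Z ω) * cutoff A (Z ω)) P := fun θ h0 h1 =>
      (integrable_const _).mono' (hmeas θ).aestronglyMeasurable (.of_forall (hbd θ h0 h1))
    have hint' : ∀ θ, 0 ≤ θ → θ ≤ T →
        Integrable (fun ω => Z ω * (Real.exp (θ * Z ω) * cutoff A (Z ω))) P := fun θ h0 h1 =>
      hZi.mul_bdd (hmeas θ).aestronglyMeasurable (.of_forall (hbd θ h0 h1))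
    have hcont : ContinuousOn m (Set.Icc 0 T) := by
      refine continuousOn_of_dominated (bound := fun _ => Real.exp (T * (A + 1)))
        (fun θ _ => (hmeas θ).aestronglyMeasurable)
        (fun θ hθ => .of_forall (hbd θ hθ.1 hθ.2)) (integrable_const _) (.of_forall fun ω => ?_)
      fun_prop
    have hderiv : ∀ θ ∈ Set.Ioo 0 T, HasDerivAt m (m' θ) θ := by
      intro θ hθ
      refine (hasDerivAt_integral_of_dominated_loc_of_deriv_le (s := Set.Ioo 0 T)
        (bound := fun ω => |Z ω| * Real.exp (T * (A + 1)))
        (F' := fun θ ω => Z ω * (Real.exp (θ * Z ω) * cutoff A (Z ω)))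
        (isOpen_Ioo.mem_nhds hθ) (.of_forall fun θ => (hmeas θ).aestronglyMeasurable)
        (hint θ hθ.1.le hθ.2.le) (hint' θ hθ.1.le hθ.2.le).1
        (.of_forall fun ω x hx => ?_) (hZi.abs.mul_const _) (.of_forall fun ω x _ => ?_)).2
      · rw [norm_mul, Real.norm_eq_abs]
        exact mul_le_mul_of_nonneg_left (hbd x hx.1.le hx.2.le ω) (abs_nonneg _)
      · have h1 : HasDerivAt (fun x => Real.exp (x * Z ω)) (Real.exp (x * Z ω) * Z ω) x := by
          simpa using ((hasDerivAt_id x).mul_const (Z ω)).exp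
        convert! h1.mul_const (cutoff A (Z ω)) using 1
        ring
    have hineq : ∀ θ ∈ Set.Ioo 0 T, m' θ ≤ b * θ * m θ := by
      intro θ hθ
      have hder : ∀ x, _root_.deriv (cutoffExp A θ) x = θ * (Real.exp (θ * x) * cutoff A x) :=
        fun x => (hasDerivAt_cutoffExp A θ x).deriv
      have hder0 : ∀ x, 0 ≤ _root_.deriv (cutoffExp A θ) x := fun x => by
        rw [hder]; exact mul_nonneg hθ.1.le (exp_mul_cutoff_nonneg A θ x)
      have hderK : ∀ x, _root_.deriv (cutoffExp A θ) x ≤ θ * Real.exp (T * (A + 1)) := fun x => by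
        rw [hder]
        exact mul_le_mul_of_nonneg_left (exp_mul_cutoff_le hA hθ.1.le hθ.2.le x) hθ.1.le
      have h1 := h (cutoffExp A θ) (contDiff_cutoffExp A θ) hder0 ⟨_, hderK⟩
      have h2 : m' θ ≤ ∫ ω, cutoffExp A θ (Z ω) * Z ω ∂P := by
        refine integral_mono (hint' θ hθ.1.le hθ.2.le) ?_ fun ω => mul_exp_cutoff_le A θ (Z ω)
        exact (memLp_comp_of_bounded_deriv hZ2 (contDiff_cutoffExp A θ) fun x => by
          rw [abs_of_nonneg (hder0 x)]; exact hderK x).integrable_mul hZ2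
      have h3 : ∫ ω, _root_.deriv (cutoffExp A θ) (Z ω) * (α * Z ω + β) ∂P =
          θ * α * m' θ + θ * β * m θ := by
        simp only [m, m']
        rw [← integral_const_mul, ← integral_const_mul, ← integral_add
          ((hint' θ hθ.1.le hθ.2.le).const_mul _) ((hint θ hθ.1.le hθ.2.le).const_mul _)]
        congr 1; ext ω
        rw [hder]; ring
      have hm0 : 0 ≤ m θ := integral_nonneg fun ω => exp_mul_cutoff_nonneg A θ _
      have h4 : (1 - α * θ) * m' θ ≤ θ * β * m θ := by linarith
      -- Replacing `1 - αθ` by the smaller `c` is legitimate only when `m' θ ≥ 0`; when it is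
      -- nonpositive the bound is immediate.
      rcases le_total (m' θ) 0 with h5 | h5
      · exact h5.trans (by have := hθ.1; positivity)
      · have h6 : c ≤ 1 - α * θ := by
          rw [← hcT]; have := mul_le_mul_of_nonneg_left hθ.2.le hα; linarith
        have h7 : c * m' θ ≤ θ * β * m θ := (mul_le_mul_of_nonneg_right h6 h5).trans h4
        rw [hb, div_mul_eq_mul_div, div_mul_eq_mul_div, le_div_iff₀ hc0]
        linarith
    have h1 := le_mul_exp_of_deriv_le hT0.le hcont hderiv hineq
    refine h1.trans (mul_le_of_le_one_left (Real.exp_pos _).le ?_)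
    calc m 0 ≤ ∫ _, (1 : ℝ) ∂P := by
          refine integral_mono (hint 0 le_rfl hT0.le) (integrable_const _) fun ω => ?_
          simpa using cutoff_le_one A (Z ω)
      _ = 1 := by simp
  have hS : MeasurableSet {ω | z ≤ Z ω} := hZm measurableSet_Ici
  -- Markov's inequality for the truncated exponential, with a bound free of `n`; dominated
  -- convergence then removes the cutoff.
  have key2 : ∀ n : ℕ, Real.exp (T * z) * ∫ ω in {ω | z ≤ Z ω}, cutoff n (Z ω) ∂P ≤
      Real.exp (b * T ^ 2 / 2) := by
    intro n
    refine le_trans ?_ (key n (Nat.cast_nonneg n))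
    have hψm : Measurable fun ω => cutoff n (Z ω) :=
      (contDiff_cutoff n).continuous.measurable.comp hZm
    have hi : Integrable (fun ω => Real.exp (T * Z ω) * cutoff n (Z ω)) P := by
      refine (integrable_const (Real.exp (T * (n + 1)))).mono'
        ((((hZm.const_mul T).exp).mul hψm).aestronglyMeasurable) (.of_forall fun ω => ?_)
      rw [Real.norm_of_nonneg (exp_mul_cutoff_nonneg _ _ _)]
      exact exp_mul_cutoff_le (Nat.cast_nonneg n) hT0.le le_rfl _
    rw [← integral_const_mul]
    refine (setIntegral_mono_on ?_ hi.integrableOn hS fun ω hω => ?_).trans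
      (setIntegral_le_integral hi (.of_forall fun ω => exp_mul_cutoff_nonneg _ _ _))
    · refine Integrable.const_mul (Integrable.integrableOn ?_) _
      exact (integrable_const (1 : ℝ)).mono' hψm.aestronglyMeasurable (.of_forall fun ω => by
        rw [Real.norm_of_nonneg (cutoff_nonneg _ _)]; exact cutoff_le_one _ _)
    · have hω' : z ≤ Z ω := hω
      refine mul_le_mul_of_nonneg_right ?_ (cutoff_nonneg _ _)
      gcongr
  have hlim : Tendsto (fun n : ℕ => ∫ ω in {ω | z ≤ Z ω}, cutoff n (Z ω) ∂P) atTop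
      (𝓝 (∫ ω in {ω | z ≤ Z ω}, (1 : ℝ) ∂P)) := by
    refine tendsto_integral_of_dominated_convergence (fun _ => 1) (fun n => ?_)
      (integrable_const _) (fun n => .of_forall fun ω => ?_) (.of_forall fun ω => ?_)
    · exact ((contDiff_cutoff n).continuous.measurable.comp hZm).aestronglyMeasurable
    · rw [Real.norm_of_nonneg (cutoff_nonneg _ _)]; exact cutoff_le_one _ _
    · refine tendsto_const_nhds.congr' ?_
      filter_upwards [eventually_ge_atTop ⌈Z ω⌉₊] with n hn
      exact (cutoff_eq_one ((Nat.le_ceil _).trans (by exact_mod_cast hn))).symm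
  have h1 := le_of_tendsto' (hlim.const_mul (Real.exp (T * z))) key2
  have h2 : ∫ ω in {ω | z ≤ Z ω}, (1 : ℝ) ∂P = P.real {ω | z ≤ Z ω} := by simp
  rw [h2, mul_comm, ← le_div_iff₀ (Real.exp_pos _), ← Real.exp_sub] at h1
  refine h1.trans (le_of_eq ?_)
  congr 1
  rw [hb, hc, hT]
  field_simp
  ring

end TailBound

/-! ### The concentration bound on Wiener space -/

section Concentration

variable {Ω H : Type*} [MeasurableSpace Ω] {P : Measure Ω} [NormedAddCommGroup H]
  [InnerProductSpace ℝ H] [CompleteSpace H] [TopologicalSpace.SeparableSpace H] {X : H → Ω → ℝ}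

/-- The factor `f(Z)` is bounded and `σ(Z)`-measurable, so it can be pulled out of the conditional
expectation. -/
lemma integral_mul_gOf [IsProbabilityMeasure P] {Z : Ω → ℝ} (hZm : Measurable Z)
    (hZ2 : MemLp Z 2 P) {f : ℝ → ℝ} (hf : Continuous f) {K : ℝ} (hK : ∀ x, ‖f x‖ ≤ K) :
    ∫ ω, f (Z ω) * steinPairing X P (hZ2.toLp Z) ω ∂P = ∫ ω, f (Z ω) * gOf X P Z hZ2 ω ∂P := by
  have hm : MeasurableSpace.comap Z inferInstance ≤ ‹MeasurableSpace Ω› := hZm.comap_le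
  have hs := integrable_steinPairing (X := X) (P := P) (hZ2.toLp Z)
  have hfm : StronglyMeasurable[MeasurableSpace.comap Z inferInstance] fun ω => f (Z ω) :=
    (hf.measurable.comp (comap_measurable Z)).stronglyMeasurable
  have h1 := condExp_stronglyMeasurable_mul_of_bound hm (μ := P) hfm hs K
    (.of_forall fun ω => hK _)
  calc ∫ ω, f (Z ω) * steinPairing X P (hZ2.toLp Z) ω ∂P
      = ∫ ω, (P[(fun ω => f (Z ω)) * steinPairing X P (hZ2.toLp Z) |
          MeasurableSpace.comap Z inferInstance]) ω ∂P := (integral_condExp hm).symm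
    _ = _ := integral_congr_ae h1

lemma concentration [IsProbabilityMeasure P] (hX : IsIsonormal X P) {Z : Ω → ℝ}
    (hZm : Measurable Z) (hZ2 : MemLp Z 2 P) (hZD : hZ2.toLp Z ∈ D12 X P)
    (hZ0 : ∫ ω, Z ω ∂P = 0) {α β : ℝ} (hα : 0 ≤ α) (hβ : 0 < β)
    (hg : ∀ᵐ ω ∂P, gOf X P Z hZ2 ω ≤ α * Z ω + β) {z : ℝ} (hz : 0 < z) :
    P.real {ω | z ≤ Z ω} ≤ Real.exp (-(z ^ 2 / (2 * α * z + 2 * β))) := by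
  refine tail_bound hZm hZ2 hα hβ (fun k hk hk0 ⟨K, hK⟩ => ?_) hz
  have hK' : ∀ x, |_root_.deriv k x| ≤ K := fun x => by rw [abs_of_nonneg (hk0 x)]; exact hK x
  have hkc : Continuous (_root_.deriv k) := hk.continuous_deriv (by simp)
  have h0 : ∫ ω, (hZ2.toLp Z) ω ∂P = 0 := by
    rw [← hZ0]; exact integral_congr_ae hZ2.coeFn_toLp
  have h1 := integral_comp_mul hX hZD h0 hk hK'
  have h2 : ∫ ω, k (Z ω) * Z ω ∂P =
      ∫ ω, _root_.deriv k (Z ω) * steinPairing X P (hZ2.toLp Z) ω ∂P := by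
    rw [integral_congr_ae (g := fun ω => k (hZ2.toLp Z ω) * hZ2.toLp Z ω), h1]
    · refine integral_congr_ae ?_
      filter_upwards [hZ2.coeFn_toLp] with ω h2 using by rw [h2]
    · filter_upwards [hZ2.coeFn_toLp] with ω h2 using by rw [h2]
  rw [h2, integral_mul_gOf hZm hZ2 hkc hK']
  have hkm : AEStronglyMeasurable (fun ω => _root_.deriv k (Z ω)) P :=
    (hkc.measurable.comp hZm).aestronglyMeasurable
  refine integral_mono_ae ?_ ?_ ?_
  · exact integrable_condExp.bdd_mul hkm (.of_forall fun ω => hK' _)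
  · exact (((hZ2.integrable one_le_two).const_mul α).add (integrable_const β)).bdd_mul hkm
      (.of_forall fun ω => hK' _)
  · filter_upwards [hg] with ω h3
    exact mul_le_mul_of_nonneg_left h3 (hk0 _)

end Concentration

lemma norm_smul_add_smul_le {E : Type*} [NormedAddCommGroup E] [NormedSpace ℝ E] {a b : ℝ}
    (ha : |a| ≤ 1) (hb : |b| ≤ 1) (p : E × E) :
    ‖a • p.1 + b • p.2‖ ≤ 2 * ‖p‖ := by
  refine (norm_add_le _ _).trans ?_
  rw [norm_smul, norm_smul, Real.norm_eq_abs, Real.norm_eq_abs]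
  have h1 := mul_le_of_le_one_left (norm_nonneg p.1) ha
  have h2 := mul_le_of_le_one_left (norm_nonneg p.2) hb
  linarith [norm_fst_le p, norm_snd_le p]

/-! ### Gaussian covariance bounds by rotation -/

section Interpolation

variable {E : Type*} [NormedAddCommGroup E] [NormedSpace ℝ E] [MeasurableSpace E]

/-- The covariance operator of a centered measure, from linear forms to vectors. -/
def covOp (μ : Measure E) (L : E →L[ℝ] ℝ) : E := ∫ y, L y • y ∂μ

variable [CompleteSpace E] [SecondCountableTopology E] [BorelSpace E] {μ : Measure E}
  [IsGaussian μ]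

lemma memLp_clm_gaussian (L : E →L[ℝ] ℝ) : MemLp (fun y => L y) 2 μ :=
  ((IsGaussian.hasGaussianLaw_id (μ := μ)).map_fun L).memLp_two

lemma integrable_covOp (L : E →L[ℝ] ℝ) : Integrable (fun y => L y • y) μ :=
  memLp_one_iff_integrable.1 (MemLp.smul (r := 1) (IsGaussian.memLp_two_id (μ := μ))
    (memLp_clm_gaussian L))

lemma apply_covOp (L K : E →L[ℝ] ℝ) : K (covOp μ L) = ∫ y, L y * K y ∂μ := by
  rw [covOp, ← K.integral_comp_comm (integrable_covOp L)]
  simp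

lemma covOp_smul (a : ℝ) (L : E →L[ℝ] ℝ) : covOp μ (a • L) = a • covOp μ L := by
  rw [covOp, covOp, ← integral_smul]
  congr 1; ext y; simp [smul_smul]

lemma ExpGrowth.integrable_gaussian {F : Type*} [NormedAddCommGroup F] {f : E → F}
    (hf : ExpGrowth f) (hm : AEStronglyMeasurable f μ) : Integrable f μ :=
  hf.integrable (V := id) IsGaussian.hasGaussianLaw_id hm

lemma hasDerivAt_interpolation {f h : E → ℝ} (hf : IsTame f) (hh : IsTame h) (t : ℝ) :
    HasDerivAt (fun t => ∫ p : E × E, f p.1 * h (Real.cos t • p.1 + Real.sin t • p.2) ∂(μ.prod μ))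
      (∫ p : E × E, f p.1 * fderiv ℝ h (Real.cos t • p.1 + Real.sin t • p.2)
        (-Real.sin t • p.1 + Real.cos t • p.2) ∂(μ.prod μ)) t := by
  have hfc := hf.continuous
  have hhc := hh.continuous
  have hhc' := hh.continuous_fderiv
  obtain ⟨C, c, hC, hc, hgr⟩ := hh.growth_fderiv
  have gf1 : ExpGrowth fun p : E × E => f p.1 :=
    hf.growth.comp_clm (ContinuousLinearMap.fst ℝ E E)
  have ghp : ExpGrowth fun p : E × E => h (Real.cos t • p.1 + Real.sin t • p.2) :=
    hh.growth.comp_lipschitz (A := 0) (K := 2) zero_le_two fun p => by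
      simpa using norm_smul_add_smul_le (Real.abs_cos_le_one t)
        (Real.abs_sin_le_one t) p
  have gb : ExpGrowth fun p : E × E => |f p.1| * ((C * Real.exp (c * (2 * ‖p‖))) * (2 * ‖p‖)) := by
    refine (gf1.of_norm_le fun p => by simp).mul (ExpGrowth.mul ?_ ?_)
    · exact ⟨C, c * 2, hC, by positivity, fun p => by
        rw [Real.norm_of_nonneg (by positivity), mul_assoc c 2]⟩
    · exact (ExpGrowth.const 2).mul (expGrowth_id.of_norm_le fun p => by simp)
  refine (hasDerivAt_integral_of_dominated_loc_of_deriv_le (s := Set.univ)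
    (bound := fun p : E × E => |f p.1| * ((C * Real.exp (c * (2 * ‖p‖))) * (2 * ‖p‖)))
    (F' := fun t p => f p.1 * fderiv ℝ h (Real.cos t • p.1 + Real.sin t • p.2)
        (-Real.sin t • p.1 + Real.cos t • p.2)) univ_mem (.of_forall fun s => ?_) ?_ ?_
    (.of_forall fun p s _ => ?_) ?_ (.of_forall fun p s _ => ?_)).2
  · exact (by fun_prop : Continuous fun p : E × E =>
      f p.1 * h (Real.cos s • p.1 + Real.sin s • p.2)).aestronglyMeasurable
  · exact (gf1.mul ghp).integrable_gaussian (by fun_prop : Continuous fun p : E × E =>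
      f p.1 * h (Real.cos t • p.1 + Real.sin t • p.2)).aestronglyMeasurable
  · exact (by fun_prop : Continuous fun p : E × E =>
      f p.1 * fderiv ℝ h (Real.cos t • p.1 + Real.sin t • p.2)
        (-Real.sin t • p.1 + Real.cos t • p.2)).aestronglyMeasurable
  · rw [norm_mul, Real.norm_eq_abs]
    refine mul_le_mul_of_nonneg_left ((ContinuousLinearMap.le_opNorm _ _).trans ?_) (abs_nonneg _)
    refine mul_le_mul ((hgr _).trans ?_) ?_ (norm_nonneg _) (by positivity)
    · gcongr
      exact norm_smul_add_smul_le (Real.abs_cos_le_one s) (Real.abs_sin_le_one s) p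
    · exact norm_smul_add_smul_le (by rw [abs_neg]; exact Real.abs_sin_le_one s)
        (Real.abs_cos_le_one s) p
  · exact gb.integrable_gaussian (by fun_prop : Continuous fun p : E × E =>
      |f p.1| * ((C * Real.exp (c * (2 * ‖p‖))) * (2 * ‖p‖))).aestronglyMeasurable
  · have h1 : HasDerivAt (fun s : ℝ => Real.cos s • p.1 + Real.sin s • p.2)
        (-Real.sin s • p.1 + Real.cos s • p.2) s :=
      ((Real.hasDerivAt_cos s).smul_const p.1).add ((Real.hasDerivAt_sin s).smul_const p.2)
    exact ((hh.differentiable _).hasFDerivAt.comp_hasDerivAt s h1).const_mul (f p.1)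

/-- `gaussian_ibp` in `y` with `w` frozen: the covariance of `L y` with `y` is `covOp μ L`, and the
inner derivative contributes `-s`. -/
lemma ibp_slice (hμ : μ[id] = 0) {f : E → ℝ} (hf : IsTame f) (L : E →L[ℝ] ℝ) (a s : ℝ) (w : E) :
    ∫ y, f (a • w - s • y) * L y ∂μ = ∫ y, -s * fderiv ℝ f (a • w - s • y) (covOp μ L) ∂μ := by
  have hlaw : HasGaussianLaw (fun y : E => (L y, y)) μ :=
    (IsGaussian.hasGaussianLaw_id (μ := μ)).map_fun (L.prod (ContinuousLinearMap.id ℝ E))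
  have hL : ∫ y, L y ∂μ = 0 := by
    rw [IsGaussian.integral_dual]
    have : ∫ y, y ∂μ = 0 := hμ
    rw [this, map_zero]
  have hbd : ∀ y : E, ‖a • w - s • y‖ ≤ ‖a • w‖ + |s| * ‖y‖ := fun y =>
    (norm_sub_le _ _).trans (by rw [norm_smul s, Real.norm_eq_abs])
  have hfd : ∀ y, fderiv ℝ (fun y => f (a • w - s • y)) y = (-s) • fderiv ℝ f (a • w - s • y) := by
    intro y
    have h1 : HasFDerivAt (fun y : E => a • w - s • y) (-(s • ContinuousLinearMap.id ℝ E)) y :=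
      ((hasFDerivAt_id y).const_smul s).const_sub (a • w)
    have h2 := ((hf.differentiable (a • w - s • y)).hasFDerivAt.comp y h1).fderiv
    refine h2.trans ?_
    ext v; simp
  have key := gaussian_ibp hlaw hL (f := fun y => f (a • w - s • y))
    (hf.contDiff_one.comp (by fun_prop)) (hf.growth.comp_lipschitz (abs_nonneg s) hbd) (by
      have h3 := (ExpGrowth.const (E := E) (-s)).smul
        (hf.growth_fderiv.comp_lipschitz (abs_nonneg s) hbd)
      exact h3.of_norm_le fun y => by rw [hfd])
  simp only [hfd] at key
  simpa [mul_comm, covOp] using key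

/-- Gaussian covariance bound by interpolation along rotations. -/
lemma covariance_le_of_interpolation (hμ : μ[id] = 0) {f h D : E → ℝ} (hf : IsTame f)
    (hh : IsTame h) (hD : Integrable D μ)
    (hle : ∀ x w, fderiv ℝ f x (covOp μ (fderiv ℝ h w)) ≤ D w) :
    ∫ x, f x * h x ∂μ - (∫ x, f x ∂μ) * ∫ x, h x ∂μ ≤ ∫ x, D x ∂μ := by
  have hfc := hf.continuous
  have hfc' := hf.continuous_fderiv
  have hhc' := hh.continuous_fderiv
  set φ : ℝ → ℝ := fun t =>
    ∫ p : E × E, f p.1 * h (Real.cos t • p.1 + Real.sin t • p.2) ∂(μ.prod μ) with hφ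
  have hbound : ∀ t ∈ Set.Icc 0 (Real.pi / 2), -(Real.sin t * ∫ x, D x ∂μ) ≤
      ∫ p : E × E, f p.1 * fderiv ℝ h (Real.cos t • p.1 + Real.sin t • p.2)
        (-Real.sin t • p.1 + Real.cos t • p.2) ∂(μ.prod μ) := by
    intro t ht
    have hsin : 0 ≤ Real.sin t :=
      Real.sin_nonneg_of_nonneg_of_le_pi ht.1 (by linarith [ht.2, Real.pi_pos])
    -- The integrand in rotated coordinates. The rotation preserves `μ.prod μ`, and it makes the
    -- argument of `fderiv ℝ h` and the vector it acts on independent, so integration by parts in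
    -- the latter applies.
    let g : E × E → ℝ := fun q =>
      f (Real.cos t • q.1 - Real.sin t • q.2) * fderiv ℝ h q.1 q.2
    have hgc : Continuous g := by fun_prop
    have hgg : ExpGrowth g := by
      refine ExpGrowth.mul ?_ ?_
      · refine hf.growth.comp_lipschitz (A := 0) (K := 2) zero_le_two fun p => ?_
        have := norm_smul_add_smul_le (Real.abs_cos_le_one t)
          (b := -Real.sin t) (by rw [abs_neg]; exact Real.abs_sin_le_one t) p
        simpa [sub_eq_add_neg] using this
      · exact (hh.growth_fderiv.comp_clm (ContinuousLinearMap.fst ℝ E E)).of_norm_le_mul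
          (expGrowth_clm (ContinuousLinearMap.snd ℝ E E)) fun p =>
            (fderiv ℝ h p.1).le_opNorm p.2
    have hgi : Integrable g (μ.prod μ) := hgg.integrable_gaussian hgc.aestronglyMeasurable
    have e1 : ∫ p : E × E, f p.1 * fderiv ℝ h (Real.cos t • p.1 + Real.sin t • p.2)
        (-Real.sin t • p.1 + Real.cos t • p.2) ∂(μ.prod μ) = ∫ q, g q ∂(μ.prod μ) := by
      have h0 := integral_map (μ := μ.prod μ) (φ := ContinuousLinearMap.rotation (E := E) t)
        (by fun_prop) (f := g) hgc.aestronglyMeasurable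
      rw [IsGaussian.map_rotation_eq_self hμ t] at h0
      rw [h0]
      congr 1; ext p
      have h1 : Real.cos t • (Real.cos t • p.1 + Real.sin t • p.2) -
          Real.sin t • (-Real.sin t • p.1 + Real.cos t • p.2) = p.1 := by
        have h2 : (Real.cos t ^ 2 + Real.sin t ^ 2) • p.1 = p.1 := by
          rw [Real.cos_sq_add_sin_sq, one_smul]
        conv_rhs => rw [← h2]
        module
      simp only [g, ContinuousLinearMap.rotation_apply, h1]
    rw [e1, integral_prod _ hgi]
    have e2 : ∀ w, ∫ y, g (w, y) ∂μ = ∫ y, -Real.sin t *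
        fderiv ℝ f (Real.cos t • w - Real.sin t • y) (covOp μ (fderiv ℝ h w)) ∂μ := fun w =>
      ibp_slice hμ hf (fderiv ℝ h w) (Real.cos t) (Real.sin t) w
    have e3 : -(Real.sin t * ∫ x, D x ∂μ) = ∫ w, -(Real.sin t * D w) ∂μ := by
      rw [integral_neg, integral_const_mul]
    rw [e3]
    refine integral_mono (hD.const_mul _).neg hgi.integral_prod_left fun w => ?_
    simp only
    rw [e2]
    have e4 : -(Real.sin t * D w) = ∫ _, -(Real.sin t * D w) ∂μ := by simp
    rw [e4]
    refine integral_mono (integrable_const _) ?_ fun y => ?_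
    · refine ExpGrowth.integrable_gaussian ((ExpGrowth.const _).mul
        ((hf.growth_fderiv.clm_comp_apply (covOp μ (fderiv ℝ h w))).comp_lipschitz
          (A := ‖Real.cos t • w‖) (abs_nonneg (Real.sin t)) fun y => ?_)) ?_
      · exact (norm_sub_le _ _).trans (by rw [norm_smul (Real.sin t), Real.norm_eq_abs])
      · exact (by fun_prop : Continuous fun y => -Real.sin t *
          fderiv ℝ f (Real.cos t • w - Real.sin t • y)
            (covOp μ (fderiv ℝ h w))).aestronglyMeasurable
    · have := mul_le_mul_of_nonneg_left (hle (Real.cos t • w - Real.sin t • y) w) hsin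
      simp only; linarith
  have hd : ∀ t, HasDerivAt (fun t => φ t - Real.cos t * ∫ x, D x ∂μ)
      ((∫ p : E × E, f p.1 * fderiv ℝ h (Real.cos t • p.1 + Real.sin t • p.2)
        (-Real.sin t • p.1 + Real.cos t • p.2) ∂(μ.prod μ)) - -Real.sin t * ∫ x, D x ∂μ) t :=
    fun t => (hasDerivAt_interpolation hf hh t).sub ((Real.hasDerivAt_cos t).mul_const _)
  have hpi : (0 : ℝ) ≤ Real.pi / 2 := by positivity
  -- At `t = 0` the two arguments coincide and at `t = π/2` they are independent, so comparing
  -- endpoints yields the covariance; `∫ sin = 1` on this interval leaves exactly `∫ D`.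
  have hmono : MonotoneOn (fun t => φ t - Real.cos t * ∫ x, D x ∂μ) (Set.Icc 0 (Real.pi / 2)) := by
    refine monotoneOn_of_deriv_nonneg (convex_Icc _ _)
      (fun t _ => (hd t).continuousAt.continuousWithinAt)
      (fun t _ => (hd t).differentiableAt.differentiableWithinAt) fun t ht => ?_
    rw [(hd t).deriv]
    have := hbound t (interior_subset ht)
    linarith
  have h1 := hmono (Set.left_mem_Icc.2 hpi) (Set.right_mem_Icc.2 hpi) hpi
  have hφ0 : φ 0 = ∫ x, f x * h x ∂μ := by
    simp only [hφ, Real.cos_zero, Real.sin_zero, one_smul, zero_smul, add_zero]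
    rw [integral_fun_fst (fun x => f x * h x)]; simp
  have hφ1 : φ (Real.pi / 2) = (∫ x, f x ∂μ) * ∫ x, h x ∂μ := by
    simp only [hφ, Real.cos_pi_div_two, Real.sin_pi_div_two, one_smul, zero_smul, zero_add]
    exact integral_prod_mul f h
  simp only [hφ0, hφ1, Real.cos_zero, Real.cos_pi_div_two] at h1
  linarith

/-- Gaussian concentration for smooth functions. -/
lemma gaussian_concentration (hμ : μ[id] = 0) {F : E → ℝ} (hF : IsTame F) {S : ℝ} (hS : 0 < S)
    (hle : ∀ x w, fderiv ℝ F x (covOp μ (fderiv ℝ F w)) ≤ S) {z : ℝ} (hz : 0 < z) :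
    μ.real {x | z ≤ F x - ∫ y, F y ∂μ} ≤ Real.exp (-(z ^ 2 / (2 * S))) := by
  set c := ∫ y, F y ∂μ
  have hFi : Integrable F μ := hF.growth.integrable_gaussian hF.continuous.aestronglyMeasurable
  have hZ : IsTame (fun x => F x + -c) := hF.add (.const _)
  have hZ2 : MemLp (fun x => F x - c) 2 μ :=
    hZ.growth.memLp_two (V := id) IsGaussian.hasGaussianLaw_id hZ.continuous.aestronglyMeasurable
  have hZd : ∀ x, fderiv ℝ (fun x => F x + -c) x = fderiv ℝ F x := fun x => fderiv_add_const _
  have hZ0 : ∫ x, (F x + -c) ∂μ = 0 := by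
    rw [integral_add hFi (integrable_const _)]; simp [c]
  have := tail_bound (Z := fun x => F x - c) (hF.continuous.measurable.sub_const c) hZ2
    (le_refl (0 : ℝ)) hS (fun k hk hk0 ⟨K, hK⟩ => ?_) hz
  · simpa using this
  · have hK' : ∀ x, |_root_.deriv k x| ≤ K := fun x => by rw [abs_of_nonneg (hk0 x)]; exact hK x
    have hkc : Continuous (_root_.deriv k) := hk.continuous_deriv (by simp)
    -- The pair is `f = F - c` and `h = k(F - c)`. The gradient of `h` at `w` carries the factor
    -- `k'(F(w) - c) ≥ 0`, so a bound depending on `w` alone is available.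
    have h1 := covariance_le_of_interpolation (μ := μ) hμ hZ (hZ.comp hk hK')
      (D := fun w => _root_.deriv k (F w + -c) * S) ?_ fun x w => ?_
    · rw [hZ0, zero_mul, sub_zero] at h1
      simpa [mul_comm, sub_eq_add_neg] using h1
    · refine Integrable.mul_const ?_ S
      exact (integrable_const K).mono' (hkc.comp hZ.continuous).aestronglyMeasurable
        (.of_forall fun x => hK' _)
    · rw [hZ.fderiv_comp hk, covOp_smul, map_smul, hZd, hZd, smul_eq_mul]
      exact mul_le_mul_of_nonneg_left (hle x w) (hk0 _)

end Interpolation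

/-! ### Smoothing the maximum -/

section LogSumExp

variable {ι : Type*} [Fintype ι]

/-- The smooth approximation `b⁻¹ log ∑ᵢ exp (b xᵢ)` of the maximum. -/
def logSumExp (b : ℝ) (x : ι → ℝ) : ℝ := b⁻¹ * Real.log (∑ i, Real.exp (b * x i))

/-- The Gibbs weights, which are the partial derivatives of `logSumExp`. -/
def gibbsWeight (b : ℝ) (x : ι → ℝ) (i : ι) : ℝ := Real.exp (b * x i) / ∑ j, Real.exp (b * x j)

variable [Nonempty ι]

lemma sum_exp_pos (b : ℝ) (x : ι → ℝ) : 0 < ∑ i, Real.exp (b * x i) :=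
  Finset.sum_pos (fun _ _ => Real.exp_pos _) Finset.univ_nonempty

lemma gibbsWeight_nonneg (b : ℝ) (x : ι → ℝ) (i : ι) : 0 ≤ gibbsWeight b x i :=
  div_nonneg (Real.exp_pos _).le (sum_exp_pos b x).le

lemma sum_gibbsWeight (b : ℝ) (x : ι → ℝ) : ∑ i, gibbsWeight b x i = 1 := by
  simp only [gibbsWeight, ← Finset.sum_div]
  exact div_self (sum_exp_pos b x).ne'

lemma hasFDerivAt_logSumExp {b : ℝ} (hb : b ≠ 0) (x : ι → ℝ) :
    HasFDerivAt (logSumExp b) (∑ i, gibbsWeight b x i •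
      (ContinuousLinearMap.proj i : (ι → ℝ) →L[ℝ] ℝ)) x := by
  have h1 : HasFDerivAt (fun x : ι → ℝ => ∑ i, Real.exp (b * x i))
      (∑ i, Real.exp (b * x i) • b • (ContinuousLinearMap.proj i : (ι → ℝ) →L[ℝ] ℝ)) x :=
    HasFDerivAt.fun_sum fun i _ =>
      ((ContinuousLinearMap.proj i : (ι → ℝ) →L[ℝ] ℝ).hasFDerivAt.const_mul b).exp
  refine ((h1.log (sum_exp_pos b x).ne').const_mul b⁻¹).congr_fderiv ?_
  rw [Finset.smul_sum, Finset.smul_sum]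
  refine Finset.sum_congr rfl fun i _ => ?_
  rw [smul_smul, smul_smul, smul_smul, gibbsWeight]
  congr 1
  field_simp

/-- The sum of exponentials is at least its largest term and, for `logSumExp_le`, at most the number
of terms times it. The error of the smoothing is thus between `0` and `log (card ι) / b`, uniformly
in `x`. -/
lemma le_logSumExp {b : ℝ} (hb : 0 < b) (x : ι → ℝ) : ⨆ i, x i ≤ logSumExp b x := by
  refine ciSup_le fun i => ?_
  rw [logSumExp, inv_mul_eq_div, le_div_iff₀ hb, mul_comm,
    Real.le_log_iff_exp_le (sum_exp_pos b x)]
  exact Finset.single_le_sum (f := fun i => Real.exp (b * x i)) (fun _ _ => (Real.exp_pos _).le)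
    (Finset.mem_univ i)

lemma logSumExp_le {b : ℝ} (hb : 0 < b) (x : ι → ℝ) :
    logSumExp b x ≤ (⨆ i, x i) + Real.log (Fintype.card ι) / b := by
  have hcard : (0 : ℝ) < Fintype.card ι := by exact_mod_cast Fintype.card_pos
  rw [logSumExp, inv_mul_eq_div, div_le_iff₀ hb, add_mul, div_mul_cancel₀ _ hb.ne',
    Real.log_le_iff_le_exp (sum_exp_pos b x), Real.exp_add, Real.exp_log hcard]
  calc ∑ i, Real.exp (b * x i) ≤ ∑ _i : ι, Real.exp ((⨆ i, x i) * b) := by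
        refine Finset.sum_le_sum fun i _ => Real.exp_le_exp.2 ?_
        rw [mul_comm]
        exact mul_le_mul_of_nonneg_right (le_ciSup (Set.finite_range x).bddAbove i) hb.le
    _ = Real.exp ((⨆ i, x i) * b) * Fintype.card ι := by simp [mul_comm]

lemma abs_iSup_le_norm (x : ι → ℝ) : |⨆ i, x i| ≤ ‖x‖ := by
  have h : ∀ i, |x i| ≤ ‖x‖ := fun i => norm_le_pi_norm x i
  obtain ⟨i⟩ := ‹Nonempty ι›
  exact abs_le.2 ⟨(abs_le.1 (h i)).1.trans (le_ciSup (Set.finite_range x).bddAbove i),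
    have : Nonempty ι := ⟨i⟩
    ciSup_le fun j => (abs_le.1 (h j)).2⟩

lemma isTame_logSumExp {b : ℝ} (hb : 0 < b) : IsTame (logSumExp b : (ι → ℝ) → ℝ) where
  contDiff := by
    have h : ContDiff ℝ ((⊤ : ℕ∞) : WithTop ℕ∞) fun x : ι → ℝ => ∑ i, Real.exp (b * x i) := by
      fun_prop
    exact contDiff_const.mul (h.log fun x => (sum_exp_pos b x).ne')
  growth := by
    have h : ExpGrowth (fun x : ι → ℝ => ‖x‖ + Real.log (Fintype.card ι) / b) :=
      (expGrowth_id.of_norm_le fun _ => by simp).add (.const _)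
    refine h.of_norm_le fun x => ?_
    have hlog : 0 ≤ Real.log (Fintype.card ι) / b := div_nonneg
      (Real.log_nonneg (by exact_mod_cast Fintype.card_pos (α := ι))) hb.le
    have h1 := abs_le.1 (abs_iSup_le_norm x)
    have h2 := le_logSumExp hb x
    have h3 := logSumExp_le hb x
    rw [Real.norm_of_nonneg (by positivity : 0 ≤ ‖x‖ + _), Real.norm_eq_abs]
    exact abs_le.2 ⟨by linarith, by linarith⟩
  growth_fderiv := by
    refine (ExpGrowth.const (E := ι → ℝ) (1 : ℝ)).of_norm_le fun x => ?_
    rw [(hasFDerivAt_logSumExp hb.ne' x).fderiv, norm_one]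
    refine ContinuousLinearMap.opNorm_le_bound _ zero_le_one fun y => ?_
    simp only [sum_apply, smul_apply,
      ContinuousLinearMap.proj_apply, smul_eq_mul]
    refine (norm_sum_le _ _).trans ?_
    rw [← sum_gibbsWeight b x, Finset.sum_mul]
    refine Finset.sum_le_sum fun i _ => ?_
    rw [norm_mul, Real.norm_of_nonneg (gibbsWeight_nonneg b x i)]
    exact mul_le_mul_of_nonneg_left (norm_le_pi_norm y i) (gibbsWeight_nonneg b x i)

/-- Jensen's inequality for the square, the Gibbs weights being a probability vector. Integrated in
`y`, it bounds the variance of the linear form by the largest coordinate variance. -/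
lemma fderiv_logSumExp_sq_le {b : ℝ} (hb : 0 < b) (x y : ι → ℝ) :
    (fderiv ℝ (logSumExp b) x y) ^ 2 ≤ ∑ i, gibbsWeight b x i * y i ^ 2 := by
  rw [(hasFDerivAt_logSumExp hb.ne' x).fderiv]
  have := (even_two.convexOn_pow (𝕜 := ℝ)).map_sum_le (t := Finset.univ) (w := gibbsWeight b x)
    (p := y) (fun i _ => gibbsWeight_nonneg b x i) (sum_gibbsWeight b x) (fun _ _ => Set.mem_univ _)
  simpa using this

variable {μ : Measure (ι → ℝ)} [IsGaussian μ]

lemma integral_fderiv_logSumExp_sq_le {b : ℝ} (hb : 0 < b) {S : ℝ}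
    (hv : ∀ i, ∫ x, x i ^ 2 ∂μ ≤ S) (x : ι → ℝ) :
    ∫ y, (fderiv ℝ (logSumExp b) x y) ^ 2 ∂μ ≤ S := by
  have hi : ∀ i, Integrable (fun y : ι → ℝ => y i ^ 2) μ := fun i =>
    (memLp_clm_gaussian (ContinuousLinearMap.proj i : (ι → ℝ) →L[ℝ] ℝ)).integrable_sq
  calc ∫ y, (fderiv ℝ (logSumExp b) x y) ^ 2 ∂μ
      ≤ ∫ y, ∑ i, gibbsWeight b x i * y i ^ 2 ∂μ :=
        integral_mono (memLp_clm_gaussian _).integrable_sq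
          (integrable_finsetSum _ fun i _ => (hi i).const_mul _)
          fun y => fderiv_logSumExp_sq_le hb x y
    _ = ∑ i, gibbsWeight b x i * ∫ y, y i ^ 2 ∂μ := by
        rw [integral_finsetSum _ fun i _ => (hi i).const_mul _]
        simp only [integral_const_mul]
    _ ≤ ∑ i, gibbsWeight b x i * S := Finset.sum_le_sum fun i _ =>
        mul_le_mul_of_nonneg_left (hv i) (gibbsWeight_nonneg b x i)
    _ = S := by rw [← Finset.sum_mul, sum_gibbsWeight, one_mul]

/-- The left side is the covariance of two linear forms with variances at most `S`; `2uv ≤ u² + v²`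
bounds it by `S` even though the gradients are taken at different points. -/
lemma fderiv_logSumExp_covOp_le {b : ℝ} (hb : 0 < b) {S : ℝ}
    (hv : ∀ i, ∫ x, x i ^ 2 ∂μ ≤ S) (x w : ι → ℝ) :
    fderiv ℝ (logSumExp b) x (covOp μ (fderiv ℝ (logSumExp b) w)) ≤ S := by
  rw [apply_covOp]
  have h1 := integral_fderiv_logSumExp_sq_le hb hv x
  have h2 := integral_fderiv_logSumExp_sq_le hb hv w
  have i1 := (memLp_clm_gaussian (μ := μ) (fderiv ℝ (logSumExp b) x)).integrable_sq
  have i2 := (memLp_clm_gaussian (μ := μ) (fderiv ℝ (logSumExp b) w)).integrable_sq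
  calc ∫ y, fderiv ℝ (logSumExp b) w y * fderiv ℝ (logSumExp b) x y ∂μ
      ≤ ∫ y, ((fderiv ℝ (logSumExp b) x y) ^ 2 + (fderiv ℝ (logSumExp b) w y) ^ 2) / 2 ∂μ := by
        refine integral_mono ((memLp_clm_gaussian _).integrable_mul (memLp_clm_gaussian _))
          ((i1.add i2).div_const 2) fun y => ?_
        have := sq_nonneg (fderiv ℝ (logSumExp b) x y - fderiv ℝ (logSumExp b) w y)
        simp only
        nlinarith
    _ ≤ S := by
        rw [integral_div, integral_add i1 i2]
        linarith

lemma measurable_iSup_coord : Measurable fun x : ι → ℝ => ⨆ i, x i :=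
  Measurable.iSup fun i => measurable_pi_apply i

lemma integrable_iSup_coord : Integrable (fun x : ι → ℝ => ⨆ i, x i) μ :=
  (IsGaussian.integrable_id (μ := μ)).mono measurable_iSup_coord.aestronglyMeasurable
    (.of_forall abs_iSup_le_norm)

/-- Concentration of plus or minus the smoothed maximum of a centered Gaussian vector. -/
lemma logSumExp_concentration (hμ : μ[id] = 0) {S : ℝ} (hS : 0 < S)
    (hv : ∀ i, ∫ x, x i ^ 2 ∂μ ≤ S) {b : ℝ} (hb : 0 < b) {s : ℝ} (hs : s ^ 2 = 1)
    {z : ℝ} (hz : 0 < z) :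
    μ.real {x | z ≤ s * (logSumExp b x - ∫ y, logSumExp b y ∂μ)} ≤
      Real.exp (-(z ^ 2 / (2 * S))) := by
  have ht := isTame_logSumExp (ι := ι) hb
  have hd : ∀ x, fderiv ℝ (fun x => s * logSumExp b x) x = s • fderiv ℝ (logSumExp b) x :=
    fun x => fderiv_const_mul (ht.differentiable x) s
  have := gaussian_concentration hμ (IsTame.mul (.const s) ht) hS (fun x w => ?_) hz
  · simpa only [integral_const_mul, ← mul_sub] using this
  · rw [hd, hd, covOp_smul, map_smul, smul_apply, smul_smul, ← sq, hs,
      one_smul]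
    exact fderiv_logSumExp_covOp_le hb hv x w

/-- Concentration of plus or minus the maximum of a centered Gaussian vector. -/
lemma iSup_concentration (hμ : μ[id] = 0) {S : ℝ} (hS : 0 < S)
    (hv : ∀ i, ∫ x, x i ^ 2 ∂μ ≤ S) {s : ℝ} (hs : s ^ 2 = 1) {z : ℝ} (hz : 0 < z) :
    μ.real {x | z ≤ s * ((⨆ i, x i) - ∫ y, ⨆ i, y i ∂μ)} ≤ Real.exp (-(z ^ 2 / (2 * S))) := by
  have hlog : 0 ≤ Real.log (Fintype.card ι) :=
    Real.log_nonneg (by exact_mod_cast Fintype.card_pos (α := ι))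
  set ε : ℕ → ℝ := fun k => Real.log (Fintype.card ι) / ((k : ℝ) + 1) with hε
  have hε0 : Tendsto ε atTop (𝓝 0) := by
    simpa [hε, div_eq_mul_inv] using
      (tendsto_one_div_add_atTop_nhds_zero_nat (𝕜 := ℝ)).const_mul (Real.log (Fintype.card ι))
  have hlim : Tendsto (fun k => Real.exp (-((z - ε k) ^ 2 / (2 * S)))) atTop
      (𝓝 (Real.exp (-(z ^ 2 / (2 * S))))) := by
    have h : Continuous fun e : ℝ => Real.exp (-((z - e) ^ 2 / (2 * S))) := by fun_prop
    have h1 := (h.tendsto 0).comp hε0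
    rwa [sub_zero] at h1
  refine ge_of_tendsto hlim ?_
  filter_upwards [hε0.eventually (gt_mem_nhds hz)] with k hk
  have hb : (0 : ℝ) < (k : ℝ) + 1 := by positivity
  have hFi : Integrable (logSumExp ((k : ℝ) + 1)) μ :=
    (isTame_logSumExp hb).growth.integrable_gaussian
      (isTame_logSumExp (ι := ι) hb).continuous.aestronglyMeasurable
  have m1 : ∫ y, ⨆ i, y i ∂μ ≤ ∫ y, logSumExp ((k : ℝ) + 1) y ∂μ :=
    integral_mono integrable_iSup_coord hFi (le_logSumExp hb)
  have m2 : ∫ y, logSumExp ((k : ℝ) + 1) y ∂μ ≤ ∫ y, ⨆ i, y i ∂μ + ε k := by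
    have := integral_mono hFi (integrable_iSup_coord.add (integrable_const (ε k)))
      (logSumExp_le (ι := ι) hb)
    rw [integral_add' integrable_iSup_coord (integrable_const _)] at this
    simpa using this
  -- Both the smoothing error at `x` and its mean lie in `[0, ε k]`, so centering changes the
  -- deviation by at most `ε k` for either sign `s`.
  refine (measureReal_mono fun x hx => ?_).trans
    (logSumExp_concentration hμ hS hv hb hs (sub_pos.2 hk))
  have l1 := le_logSumExp hb x
  have l2 := logSumExp_le hb x
  rw [Set.mem_ofPred_eq] at hx ⊢
  rcases mul_self_eq_one_iff.1 ((sq s).symm.trans hs) with rfl | rfl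
  · linarith
  · linarith

end LogSumExp

/-- Both tail bounds for the centered maximum of a centered Gaussian vector. -/
lemma centeredMax_tail {Ω : Type*} [MeasurableSpace Ω] {P : Measure Ω} {n : ℕ} (hn : 1 ≤ n)
    {N : Fin n → Ω → ℝ} (hN : HasGaussianLaw (fun ω i => N i ω) P)
    (hN0 : ∀ i, ∫ ω, N i ω ∂P = 0) (hv : ∃ i, 0 < ∫ ω, N i ω ^ 2 ∂P) {s : ℝ} (hs : s ^ 2 = 1)
    {z : ℝ} (hz : 0 < z) :
    P.real {ω | z ≤ s * centeredMax P N ω} ≤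
      Real.exp (-(z ^ 2 / (2 * ⨆ i, ∫ ω, N i ω ^ 2 ∂P))) := by
  have : Nonempty (Fin n) := ⟨⟨0, hn⟩⟩
  have hm : AEMeasurable (fun ω i => N i ω) P := hN.aemeasurable
  have : IsGaussian (P.map fun ω i => N i ω) := hN.isGaussian_map
  set μ := P.map fun ω i => N i ω with hμd
  have hbdd : BddAbove (Set.range fun i => ∫ ω, N i ω ^ 2 ∂P) := (Set.finite_range _).bddAbove
  have hS : 0 < ⨆ i, ∫ ω, N i ω ^ 2 ∂P := by
    obtain ⟨i, hi⟩ := hv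
    exact hi.trans_le (le_ciSup hbdd i)
  have hμ : μ[id] = 0 := by
    ext i
    have h1 := (ContinuousLinearMap.proj i : (Fin n → ℝ) →L[ℝ] ℝ).integral_comp_comm
      (IsGaussian.integrable_id (μ := μ))
    simp only [ContinuousLinearMap.proj_apply, id] at h1
    simp only [id, Pi.zero_apply]
    rw [← h1, hμd, integral_map hm (measurable_pi_apply i).aestronglyMeasurable, hN0 i]
  have hvar : ∀ i, ∫ x, x i ^ 2 ∂μ ≤ ⨆ i, ∫ ω, N i ω ^ 2 ∂P := fun i => by
    rw [hμd, integral_map hm ((measurable_pi_apply i).pow_const 2).aestronglyMeasurable]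
    exact le_ciSup hbdd i
  have hmax : ∫ x, ⨆ i, x i ∂μ = ∫ ω, ⨆ i, N i ω ∂P :=
    integral_map hm measurable_iSup_coord.aestronglyMeasurable
  have key := iSup_concentration hμ hS hvar hs hz
  rwa [hmax, measureReal_def, hμd, Measure.map_apply_of_aemeasurable hm
    (measurableSet_le measurable_const ((measurable_iSup_coord.sub_const _).const_mul s))] at key

end Malliavin

end

theorem theorem4p1 {Ω H : Type*} [MeasurableSpace Ω] (P : Measure Ω) [IsProbabilityMeasure P]
    [NormedAddCommGroup H] [InnerProductSpace ℝ H] [CompleteSpace H]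
    [TopologicalSpace.SeparableSpace H]
    (X : H → Ω → ℝ) (hX : Malliavin.IsIsonormal X P) :
    -- the concentration bound
    (∀ (Z : Ω → ℝ) (_ : Measurable Z) (hZ2 : MemLp Z 2 P)
        (_ : hZ2.toLp Z ∈ Malliavin.D12 X P) (_ : ∫ ω, Z ω ∂P = 0)
        (_ : HasPDF Z P volume)
        (α β : ℝ) (_ : 0 ≤ α) (_ : 0 < β)
        (_ : ∀ᵐ ω ∂P, Malliavin.gOf X P Z hZ2 ω ≤ α * Z ω + β)
        (z : ℝ) (_ : 0 < z),
        P.real {ω | z ≤ Z ω} ≤ Real.exp (-(z ^ 2 / (2 * α * z + 2 * β)))) ∧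
    -- the two tail bounds for the centered maximum of a centered Gaussian vector
    (∀ (n : ℕ) (_ : 1 ≤ n) (N : Fin n → Ω → ℝ)
        (_ : HasGaussianLaw (fun ω i => N i ω) P) (_ : ∀ i, ∫ ω, N i ω ∂P = 0)
        (_ : ∃ i, 0 < ∫ ω, N i ω ^ 2 ∂P)
        (z : ℝ) (_ : 0 < z),
        P.real {ω | z ≤ Malliavin.centeredMax P N ω} ≤
            Real.exp (-(z ^ 2 / (2 * ⨆ i, ∫ ω, N i ω ^ 2 ∂P))) ∧
        P.real {ω | Malliavin.centeredMax P N ω ≤ -z} ≤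
            Real.exp (-(z ^ 2 / (2 * ⨆ i, ∫ ω, N i ω ^ 2 ∂P)))) := by
  refine ⟨fun Z hZm hZ2 hZD hZ0 _ α β hα hβ hg z hz =>
    Malliavin.concentration hX hZm hZ2 hZD hZ0 hα hβ hg hz, fun n hn N hN hN0 hv z hz => ⟨?_, ?_⟩⟩
  · simpa using Malliavin.centeredMax_tail hn hN hN0 hv (s := 1) (by norm_num) hz
  · simpa [le_neg] using Malliavin.centeredMax_tail hn hN hN0 hv (s := -1) (by norm_num) hz
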